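/- A graph is $H$-free if it contains no (not necessarily induced) subgraph isomorphic to $H$. For $m\ge 1$ let $B_m$ be the book graph consisting of $m$ triangles sharing a common edge. Let $\mathrm{ex}_3(n,B_{r+1})$ denote the maximum number of edges of a non-bipartite $B_{r+1}$-free simple graph on $n$ vertices, and let $\mathrm{Ex}_3(n,B_{r+1})$ denote the set of all non-bipartite $B_{r+1}$-free graphs on $n$ vertices with exactly $\mathrm{ex}_3(n,B_{r+1})$ edges. Graphs are considered up to isomorphism. Let $T_{n-3,2}$ be the balanced complete bipartite graph on $n-3$ vertices, with parts $S^\star$ and $T^\star$, whose sizes differ by at most one. Let $\mathscr{G}_1(B_2)$ be the family of all $n$-vertex graphs obtained from the disjoint union of $T_{n-3,2}$ and a triangle $w_1w_2w_3$ by choosing subsets $S_1\subseteq S^\star$ and $T_1\subseteq T^\star$ with $|S_1||T_1|\le 1$ and joining $w_3$ to all vertices in $S_1\cup T_1$, $w_1$ to all vertices in $S^\star\setminus S_1$, and $w_2$ to all vertices in $T^\star\setminus T_1$. Let $K^{r,r}_{\lfloor (n-1)/2\rfloor,\lceil (n-1)/2\rceil}$ be the graph obtained from the complete bipartite graph $K_{\lfloor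 (n-1)/2\rfloor,\lceil (n-1)/2\rceil}$ by adding one new vertex that has exactly $r$ neighbours in each part. Theorem. For every integer $r\ge 1$ there is an $n_0=n_0(r)$ such that for all $n\ge n_0$, $$\mathrm{ex}_3(n,B_{r+1})=\left\lfloor\frac{(n-1)^2}{4}\right\rfloor+2r.$$ Moreover, $\mathrm{Ex}_3(n,B_{r+1})=\mathscr{G}_1(B_2)$ if $r=1$, and $\mathrm{Ex}_3(n,B_{r+1})=\big\{K^{r,r}_{\lfloor (n-1)/2\rfloor,\lceil (n-1)/2\rceil}\big\}$ if $r\ge 2$. -/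

import Mathlib

/-- The book graph `B_m`: `m` triangles sharing a common edge. The ends of the common edge are
`inl 0` and `inl 1`, and the third vertices of the triangles are `inr 0, …, inr (m - 1)`. -/
def bookGraph (m : ℕ) : SimpleGraph (Fin 2 ⊕ Fin m) :=
  SimpleGraph.fromRel fun
    | .inl _, .inl _ => True
    | .inl _, .inr _ => True
    | .inr _, .inl _ => True
    | .inr _, .inr _ => False

/-- `G` is a non-bipartite graph that contains no (not necessarily induced) copy of `H`. -/
def IsNonBipartiteFree {V W : Type*} (H : SimpleGraph W) (G : SimpleGraph V) : Prop :=
  ¬ G.IsBipartite ∧ H.Free G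

/-- The edge numbers of the non-bipartite `H`-free graphs on `n` vertices; `ex₃(n, H)` is the
greatest element of this set. -/
def nonBipartiteEdgeNumbers {W : Type*} (n : ℕ) (H : SimpleGraph W) : Set ℕ :=
  {m | ∃ G : SimpleGraph (Fin n), IsNonBipartiteFree H G ∧ G.edgeSet.ncard = m}

/-- `Ex₃(n, H)`: the non-bipartite `H`-free graphs on `n` (labelled) vertices with the maximum
number of edges among all such graphs. -/
def nonBipartiteExtremalGraphs {W : Type*} (n : ℕ) (H : SimpleGraph W) :
    Set (SimpleGraph (Fin n)) :=
  {G | IsNonBipartiteFree H G ∧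
    ∀ G' : SimpleGraph (Fin n), IsNonBipartiteFree H G' → G'.edgeSet.ncard ≤ G.edgeSet.ncard}

/-- The graph obtained from the complete bipartite graph with parts `S`, `T` and a triangle
`w₁ w₂ w₃` (the vertices `inr 0`, `inr 1`, `inr 2`) by joining `w₃` to all of `S₁ ∪ T₁`,
`w₁` to all of `S \ S₁` and `w₂` to all of `T \ T₁`. -/
def triangleAttachment {S T : Type*} (S₁ : Set S) (T₁ : Set T) :
    SimpleGraph ((S ⊕ T) ⊕ Fin 3) :=
  SimpleGraph.fromRel fun
    | .inl x, .inl y => (completeBipartiteGraph S T).Adj x y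
    | .inr _, .inr _ => True
    | .inr j, .inl (.inl s) => (j = 0 ∧ s ∉ S₁) ∨ (j = 2 ∧ s ∈ S₁)
    | .inr j, .inl (.inr t) => (j = 1 ∧ t ∉ T₁) ∨ (j = 2 ∧ t ∈ T₁)
    | .inl _, .inr _ => False

/-- The family `𝒢₁(B₂)` on `n` labelled vertices: all graphs isomorphic to a triangle attachment
over the Turán graph `T_{n-3,2}` (the complete bipartite graph with `s + t = n - 3` and
`|s - t| ≤ 1`, either part being called `S`) with `|S₁| |T₁| ≤ 1`. -/
def familyG1 (n : ℕ) : Set (SimpleGraph (Fin n)) :=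
  {G | ∃ s t : ℕ, s + t + 3 = n ∧ s ≤ t + 1 ∧ t ≤ s + 1 ∧
    ∃ (S₁ : Set (Fin s)) (T₁ : Set (Fin t)), S₁.ncard * T₁.ncard ≤ 1 ∧
      Nonempty (G ≃g triangleAttachment S₁ T₁)}

/-- The graph `K_{s,t}^{r,r}` (for `r ≤ s` and `r ≤ t`): the complete bipartite graph `K_{s,t}`
together with a new vertex `none` that is joined to `r` vertices of each part. -/
def bipartitePlusVertex (r s t : ℕ) : SimpleGraph (Option (Fin s ⊕ Fin t)) :=
  SimpleGraph.fromRel fun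
    | some x, some y => (completeBipartiteGraph (Fin s) (Fin t)).Adj x y
    | none, some (.inl i) => i.val < r
    | none, some (.inr j) => j.val < r
    | _, none => False

/-! Forbidding the book means that every edge lies in at most `r` triangles. The proof is a
stability argument followed by an exact count.

Stability (`BookFree.exists_bipartite_delete`): a graph with about `n²/4 - n/2` edges has a cut with
only linearly many inner edges and missing cross pairs. An edge `xy` inside one part forces `x` and
`y` together to miss all but `r` vertices of the other part. In an optimal cut this first makes
inner degrees small compared with `n`, and then makes the number of ordered inner pairs at most
`n/10`, so at most about `0.55 n` cross pairs are missing. Two disjoint inner edges, or an inner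
triangle, would cost at least about `0.6 n` missing pairs. Hence the inner edges form a star, and
deleting its centre `w` leaves a bipartite graph.

Exact count (`IsVertexSplit.ncard_edgeSet_le`): let `X`, `Y` be the parts of `G - w`, let `P`, `Q`
be the neighbourhoods of `w` in them, with sizes `a` and `b`, and let `e` be the number of edges
between `P` and `Q`. Then `G` has at most `|X||Y| - (ab - e) + a + b` edges. Non-bipartiteness gives
`a, b ≥ 1`, and book-freeness gives `e ≤ r min(a, b)`, whence `a + b + e ≤ 2r + ab`. Equality forces
balanced parts, no missing pair outside `P × Q`, and either `a = b = r` with `P`, `Q` completely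
joined, or `r = 1` and a short list of matchings. These are the claimed extremal graphs. -/

section

/-! ### Book-freeness as a codegree condition, and counting adjacent pairs -/

open Finset

namespace SimpleGraph

variable {V : Type*}

/-- Every edge of `G` lies in at most `r` triangles. -/
def BookFree (G : SimpleGraph V) (r : ℕ) : Prop :=
  ∀ u v, G.Adj u v → (G.commonNeighbors u v).ncard ≤ r

open Classical in
/-- The number of neighbours of `x` in `S`. -/
noncomputable def degIn (G : SimpleGraph V) (S : Finset V) (x : V) : ℕ := #{y ∈ S | G.Adj x y}

/-- The number of ordered pairs `(x, y) ∈ S × T` with `x` adjacent to `y`. -/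
noncomputable def pairCount (G : SimpleGraph V) (S T : Finset V) : ℕ := ∑ x ∈ S, G.degIn T x

theorem free_bookGraph_iff [Finite V] (G : SimpleGraph V) (r : ℕ) :
    (bookGraph (r + 1)).Free G ↔ G.BookFree r := by
  classical
  constructor
  · intro h u v huv
    by_contra! hlt
    apply h
    obtain ⟨T, hT, hTc⟩ := Set.exists_subset_card_eq (s := G.commonNeighbors u v) (n := r + 1) hlt
    have : Fintype T := Fintype.ofFinite T
    have e : Fin (r + 1) ≃ T := (Fintype.equivFinOfCardEq (by
      rw [← Nat.card_eq_fintype_card, Nat.card_coe_set_eq, hTc])).symm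
    have hu : ∀ i, G.Adj u (e i) := fun i => (hT (e i).2).1
    have hv : ∀ i, G.Adj v (e i) := fun i => (hT (e i).2).2
    let f : Fin 2 ⊕ Fin (r + 1) → V := Sum.elim ![u, v] (fun i => (e i : V))
    have hf : Function.Injective f := by
      rintro (i | i) (j | j) hij
      · fin_cases i <;> fin_cases j <;> simp [f] at hij ⊢
        · exact huv.ne hij
        · exact huv.ne' hij
      · fin_cases i <;> simp [f] at hij
        · exact absurd hij (hu j).ne
        · exact absurd hij (hv j).ne
      · fin_cases j <;> simp [f] at hij
        · exact absurd hij (hu i).ne'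
        · exact absurd hij (hv i).ne'
      · exact congrArg _ (e.injective (Subtype.ext hij))
    refine ⟨⟨⟨f, ?_⟩, hf⟩⟩
    rintro (i | i) (j | j) hij
    · fin_cases i <;> fin_cases j <;> simp [f, bookGraph] at hij ⊢
      · exact huv
      · exact huv.symm
    · fin_cases i
      · exact hu j
      · exact hv j
    · fin_cases j
      · exact (hu i).symm
      · exact (hv i).symm
    · simp [bookGraph] at hij
  · rintro h ⟨f⟩
    have h01 : (bookGraph (r + 1)).Adj (.inl 0) (.inl 1) := by simp [bookGraph]
    have hle := h _ _ (f.toHom.map_adj h01)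
    have hsub : Set.range (fun i : Fin (r + 1) => f (.inr i)) ⊆
        G.commonNeighbors (f (.inl 0)) (f (.inl 1)) := by
      rintro _ ⟨i, rfl⟩
      exact ⟨f.toHom.map_adj (by simp [bookGraph]), f.toHom.map_adj (by simp [bookGraph])⟩
    have hc := Set.ncard_le_ncard hsub (Set.toFinite _)
    rw [← Set.image_univ, Set.ncard_image_of_injective _ (fun i j hij => by
      simpa using f.injective hij), Set.ncard_univ, Nat.card_eq_fintype_card,
      Fintype.card_fin] at hc
    exact absurd (hc.trans hle) (by simp)

variable {G : SimpleGraph V} {r : ℕ}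

theorem degIn_eq_card (G : SimpleGraph V) [DecidableRel G.Adj] (S : Finset V) (x : V) :
    G.degIn S x = #{y ∈ S | G.Adj x y} := by
  unfold degIn
  congr

theorem pairCount_comm (G : SimpleGraph V) (S T : Finset V) :
    G.pairCount S T = G.pairCount T S := by
  classical
  simp only [pairCount, degIn, card_filter]
  rw [sum_comm]
  simp only [G.adj_comm]

theorem degIn_le_card (G : SimpleGraph V) (S : Finset V) (x : V) : G.degIn S x ≤ #S := by
  classical
  unfold degIn
  exact card_filter_le _ _

theorem degIn_mono (G : SimpleGraph V) {S T : Finset V} (h : S ⊆ T) (x : V) :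
    G.degIn S x ≤ G.degIn T x := by
  classical
  unfold degIn
  gcongr

theorem degIn_union [DecidableEq V] (G : SimpleGraph V) {S T : Finset V} (h : Disjoint S T)
    (x : V) : G.degIn (S ∪ T) x = G.degIn S x + G.degIn T x := by
  classical
  rw [degIn, filter_union, card_union_of_disjoint (disjoint_filter_filter h), degIn, degIn]

theorem degIn_eq_zero {S : Finset V} {x : V} (h : ∀ y ∈ S, ¬ G.Adj x y) : G.degIn S x = 0 := by
  classical
  rw [degIn, card_eq_zero, filter_eq_empty_iff]
  exact fun y hy => h y hy

theorem pairCount_union_left [DecidableEq V] (G : SimpleGraph V) {S T : Finset V}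
    (h : Disjoint S T) (U : Finset V) :
    G.pairCount (S ∪ T) U = G.pairCount S U + G.pairCount T U :=
  sum_union h

theorem pairCount_union_right [DecidableEq V] (G : SimpleGraph V) {S T : Finset V}
    (h : Disjoint S T) (U : Finset V) :
    G.pairCount U (S ∪ T) = G.pairCount U S + G.pairCount U T := by
  simp only [pairCount, degIn_union G h, sum_add_distrib]

theorem pairCount_singleton_left (G : SimpleGraph V) (x : V) (U : Finset V) :
    G.pairCount {x} U = G.degIn U x := by
  simp [pairCount]

theorem pairCount_le_card_mul (G : SimpleGraph V) (S T : Finset V) :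
    G.pairCount S T ≤ #S * #T := by
  have := sum_le_card_nsmul S (G.degIn T) #T (fun x _ => G.degIn_le_card T x)
  simpa [pairCount] using this

theorem pairCount_eq_sum [DecidableRel G.Adj] (S T : Finset V) :
    G.pairCount S T = ∑ x ∈ S, ∑ y ∈ T, if G.Adj x y then 1 else 0 := by
  simp only [pairCount, degIn, card_filter]
  refine sum_congr rfl fun x _ => sum_congr rfl fun y _ => ?_
  congr

theorem two_mul_ncard_edgeSet [Fintype V] (G : SimpleGraph V) :
    2 * G.edgeSet.ncard = G.pairCount univ univ := by
  classical
  rw [← coe_edgeFinset, Set.ncard_coe_finset, ← sum_degrees_eq_twice_card_edges]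
  refine sum_congr rfl fun x _ => ?_
  rw [degIn, ← card_neighborFinset_eq_degree, neighborFinset_eq_filter]

theorem two_mul_ncard_edgeSet_eq_of_compl [Fintype V] [DecidableEq V] (G : SimpleGraph V) (A : Finset V) :
    2 * G.edgeSet.ncard = G.pairCount A A + G.pairCount Aᶜ Aᶜ + 2 * G.pairCount A Aᶜ := by
  rw [two_mul_ncard_edgeSet, ← union_compl A, pairCount_union_left G disjoint_compl_right,
    pairCount_union_right G disjoint_compl_right, pairCount_union_right G disjoint_compl_right,
    pairCount_comm G Aᶜ A]
  ring

theorem BookFree.card_le [Finite V] (h : G.BookFree r) {x y : V} (hxy : G.Adj x y) (S : Finset V)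
    (hS : ∀ z ∈ S, G.Adj x z ∧ G.Adj y z) : #S ≤ r := by
  rw [← Set.ncard_coe_finset]
  exact (Set.ncard_le_ncard (fun z hz => hS z hz) (Set.toFinite _)).trans (h x y hxy)

theorem BookFree.degIn_add_degIn_le [Finite V] (h : G.BookFree r) {x y : V} (hxy : G.Adj x y)
    (S : Finset V) : G.degIn S x + G.degIn S y ≤ #S + r := by
  classical
  rw [degIn, degIn, ← card_union_add_card_inter]
  refine add_le_add (card_le_card (union_subset (filter_subset _ _) (filter_subset _ _)))
    (h.card_le hxy _ fun z hz => ?_)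
  simp only [mem_inter, mem_filter] at hz
  exact ⟨hz.1.2, hz.2.2⟩

theorem BookFree.degIn_le [Finite V] (h : G.BookFree r) {x y : V} (hxy : G.Adj x y) {S : Finset V}
    (hS : ∀ z ∈ S, G.Adj x z) : G.degIn S y ≤ r := by
  classical
  refine h.card_le hxy _ fun z hz => ?_
  rw [mem_filter] at hz
  exact ⟨hS z hz.1, hz.2⟩

/-- A neighbour in `Q` of a vertex `x` of `P` is a common neighbour of the ends of the edge `wx`, so
each `x` has at most `r` of them. -/
theorem BookFree.pairCount_le [Finite V] (h : G.BookFree r) {w : V} {P Q : Finset V}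
    (hP : ∀ z ∈ P, G.Adj w z) (hQ : ∀ z ∈ Q, G.Adj w z) : G.pairCount P Q ≤ r * #P := by
  have := sum_le_card_nsmul P (G.degIn Q) r (fun x hx => h.degIn_le (hP x hx) hQ)
  rw [mul_comm]
  simpa [pairCount] using this

theorem BookFree.map_iso {W : Type*} [Finite V] {H : SimpleGraph W} (e : G ≃g H)
    (h : G.BookFree r) : H.BookFree r := by
  intro u v huv
  have := h (e.symm u) (e.symm v) (e.symm.map_adj_iff.2 huv)
  refine le_trans ?_ this
  rw [← Set.ncard_image_of_injective _ e.symm.injective]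
  refine Set.ncard_le_ncard ?_ (Set.toFinite _)
  rintro _ ⟨z, ⟨h1, h2⟩, rfl⟩
  exact ⟨e.symm.map_adj_iff.2 h1, e.symm.map_adj_iff.2 h2⟩

end SimpleGraph

end

/-! ### The cost of inner edges in missing cross pairs, and the choice of a cut -/

section

open Finset

namespace SimpleGraph

variable {V : Type*} {G : SimpleGraph V} {r : ℕ}

theorem pairCount_mono (G : SimpleGraph V) {S S' T T' : Finset V} (hS : S ⊆ S') (hT : T ⊆ T') :
    G.pairCount S T ≤ G.pairCount S' T' :=
  (sum_le_sum fun x _ => G.degIn_mono hT x).trans (sum_le_sum_of_subset hS)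

theorem degIn_add_degIn_compl (G : SimpleGraph V) {S : Finset V} {x : V} (hx : x ∉ S) :
    G.degIn S x + Gᶜ.degIn S x = #S := by
  classical
  have h : Gᶜ.degIn S x = #{y ∈ S | ¬ G.Adj x y} := by
    rw [degIn_eq_card]
    congr 1
    ext y
    rw [mem_filter, mem_filter, compl_adj]
    exact ⟨fun h => ⟨h.1, h.2.2⟩, fun h => ⟨h.1, fun e => hx (e ▸ h.1), h.2⟩⟩
  rw [h]
  unfold degIn
  exact card_filter_add_card_filter_not _

theorem pairCount_add_pairCount_compl (G : SimpleGraph V) {S T : Finset V} (h : Disjoint S T) :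
    G.pairCount S T + Gᶜ.pairCount S T = #S * #T := by
  rw [pairCount, pairCount, ← sum_add_distrib,
    sum_congr rfl fun x hx => G.degIn_add_degIn_compl (Finset.disjoint_left.1 h hx)]
  simp

theorem sum_degIn_le_pairCount (G : SimpleGraph V) {S A : Finset V} (h : S ⊆ A) (B : Finset V) :
    ∑ x ∈ S, G.degIn B x ≤ G.pairCount A B :=
  sum_le_sum_of_subset h

section Partition

variable {A B : Finset V}

theorem BookFree.card_le_degIn_compl [Finite V] (h : G.BookFree r) {x y : V}
    (hxy : G.Adj x y) (hx : x ∉ B) (hy : y ∉ B) :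
    #B ≤ Gᶜ.degIn B x + Gᶜ.degIn B y + r := by
  have h1 := h.degIn_add_degIn_le hxy B
  have h2 := G.degIn_add_degIn_compl hx
  have h3 := G.degIn_add_degIn_compl hy
  omega

/-- Between the neighbourhoods `P ⊆ A` and `Q ⊆ B` of `x` there are at most `r|P|` adjacent pairs,
so at least `|P||Q| - r|P|` cross pairs are missing, and `|Q| ≥ |P|`. -/
theorem BookFree.degIn_mul_self_le [Finite V] (h : G.BookFree r) (hAB : Disjoint A B) {x : V}
    (hx : G.degIn A x ≤ G.degIn B x) :
    G.degIn A x * G.degIn A x ≤ Gᶜ.pairCount A B + r * G.degIn A x := by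
  classical
  obtain ⟨P, hP⟩ : ∃ P : Finset V, P = {y ∈ A | G.Adj x y} := ⟨_, rfl⟩
  obtain ⟨Q, hQ⟩ : ∃ Q : Finset V, Q = {y ∈ B | G.Adj x y} := ⟨_, rfl⟩
  have hPA : P ⊆ A := hP ▸ filter_subset _ _
  have hQB : Q ⊆ B := hQ ▸ filter_subset _ _
  have e1 : G.degIn A x = #P := hP ▸ rfl
  have e2 : G.degIn B x = #Q := hQ ▸ rfl
  have h1 := G.pairCount_add_pairCount_compl
    (hAB.mono hPA hQB)
  have h2 : G.pairCount P Q ≤ r * #P :=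
    h.pairCount_le (w := x) (fun z hz => (mem_filter.1 (hP ▸ hz)).2)
      (fun z hz => (mem_filter.1 (hQ ▸ hz)).2)
  have h3 := Gᶜ.pairCount_mono hPA hQB
  rw [e1, e2] at hx
  rw [e1]
  have := Nat.mul_le_mul_left #P hx
  omega

/-- Sum `card_le_degIn_compl` over the ordered inner adjacent pairs. The missing degree of each
vertex is counted at most `K` times in each of the two positions. -/
theorem BookFree.pairCount_self_mul_card_le [Finite V] (h : G.BookFree r) (hAB : Disjoint A B)
    {K : ℕ} (hK : ∀ x ∈ A, G.degIn A x ≤ K) :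
    G.pairCount A A * #B ≤ 2 * K * Gᶜ.pairCount A B + r * G.pairCount A A := by
  classical
  have key : ∑ x ∈ A, ∑ y ∈ A, (if G.Adj x y then Gᶜ.degIn B x else 0) ≤
      K * Gᶜ.pairCount A B := by
    rw [pairCount, mul_sum]
    refine sum_le_sum fun x hx => ?_
    rw [← sum_filter, sum_const, smul_eq_mul]
    exact Nat.mul_le_mul_right _ (hK x hx)
  have key' : ∑ x ∈ A, ∑ y ∈ A, (if G.Adj x y then Gᶜ.degIn B y else 0) ≤
      K * Gᶜ.pairCount A B := by
    rw [sum_comm]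
    simpa only [G.adj_comm] using key
  calc G.pairCount A A * #B = ∑ x ∈ A, ∑ y ∈ A, (if G.Adj x y then #B else 0) := by
        rw [pairCount_eq_sum]
        simp only [sum_mul, ite_mul, one_mul, zero_mul]
    _ ≤ ∑ x ∈ A, ∑ y ∈ A, ((if G.Adj x y then Gᶜ.degIn B x else 0) +
          (if G.Adj x y then Gᶜ.degIn B y else 0) + r * (if G.Adj x y then 1 else 0)) := by
        refine sum_le_sum fun x hx => sum_le_sum fun y hy => ?_
        split_ifs with hxy
        · simpa using h.card_le_degIn_compl hxy (Finset.disjoint_left.1 hAB hx) (Finset.disjoint_left.1 hAB hy)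
        · simp
    _ ≤ _ := by
        simp only [sum_add_distrib, ← mul_sum, ← pairCount_eq_sum]
        linarith

theorem BookFree.two_mul_card_le [Finite V] (h : G.BookFree r) (hAB : Disjoint A B)
    {x y x' y' : V} (hx : x ∈ A) (hy : y ∈ A) (hx' : x' ∈ A) (hy' : y' ∈ A)
    (hxy : G.Adj x y) (hxy' : G.Adj x' y') (h1 : x ≠ x') (h2 : x ≠ y') (h3 : y ≠ x')
    (h4 : y ≠ y') : 2 * #B ≤ Gᶜ.pairCount A B + 2 * r := by
  classical
  have hs : ({x, y, x', y'} : Finset V) ⊆ A := by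
    simp [insert_subset_iff, hx, hy, hx', hy']
  have := Gᶜ.sum_degIn_le_pairCount hs B
  rw [sum_insert (by simp [hxy.ne, h1, h2]), sum_insert (by simp [h3, h4]),
    sum_insert (by simp [hxy'.ne]), sum_singleton] at this
  have e1 := h.card_le_degIn_compl hxy (Finset.disjoint_left.1 hAB hx) (Finset.disjoint_left.1 hAB hy)
  have e2 := h.card_le_degIn_compl hxy' (Finset.disjoint_left.1 hAB hx') (Finset.disjoint_left.1 hAB hy')
  omega

theorem BookFree.three_mul_card_le [Finite V] (h : G.BookFree r) (hAB : Disjoint A B)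
    {x y z : V} (hx : x ∈ A) (hy : y ∈ A) (hz : z ∈ A)
    (hxy : G.Adj x y) (hyz : G.Adj y z) (hxz : G.Adj x z) :
    3 * #B ≤ 2 * Gᶜ.pairCount A B + 3 * r := by
  classical
  have hs : ({x, y, z} : Finset V) ⊆ A := by
    simp [insert_subset_iff, hx, hy, hz]
  have := Gᶜ.sum_degIn_le_pairCount hs B
  rw [sum_insert (by simp [hxy.ne, hxz.ne]), sum_insert (by simp [hyz.ne]),
    sum_singleton] at this
  have e1 := h.card_le_degIn_compl hxy (Finset.disjoint_left.1 hAB hx) (Finset.disjoint_left.1 hAB hy)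
  have e2 := h.card_le_degIn_compl hyz (Finset.disjoint_left.1 hAB hy) (Finset.disjoint_left.1 hAB hz)
  have e3 := h.card_le_degIn_compl hxz (Finset.disjoint_left.1 hAB hx) (Finset.disjoint_left.1 hAB hz)
  omega

/-- The two edges lie on opposite sides, so a missing pair between their ends is counted from both.
There are at most four such pairs, which gives the `4`. -/
theorem BookFree.card_add_card_le [Finite V] (h : G.BookFree r) (hAB : Disjoint A B)
    {x y x' y' : V} (hx : x ∈ A) (hy : y ∈ A) (hx' : x' ∈ B) (hy' : y' ∈ B)
    (hxy : G.Adj x y) (hxy' : G.Adj x' y') :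
    #A + #B ≤ Gᶜ.pairCount A B + 2 * r + 4 := by
  classical
  have hs : ({x, y} : Finset V) ⊆ A := by simp [insert_subset_iff, hx, hy]
  have hs' : ({x', y'} : Finset V) ⊆ B := by simp [insert_subset_iff, hx', hy']
  have hd : Disjoint ({x, y} : Finset V) (A \ {x, y}) := disjoint_sdiff
  have hA : {x, y} ∪ A \ {x, y} = A := union_sdiff_of_subset hs
  have e0 : Gᶜ.pairCount {x, y} B + Gᶜ.pairCount (A \ {x, y}) B = Gᶜ.pairCount A B := by
    rw [← pairCount_union_left Gᶜ hd, hA]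
  have e1 : Gᶜ.pairCount {x', y'} (A \ {x, y}) ≤ Gᶜ.pairCount (A \ {x, y}) B := by
    rw [pairCount_comm]
    exact pairCount_mono _ Subset.rfl hs'
  have e2 : Gᶜ.pairCount {x', y'} {x, y} + Gᶜ.pairCount {x', y'} (A \ {x, y}) =
      Gᶜ.pairCount {x', y'} A := by
    rw [← pairCount_union_right Gᶜ hd, hA]
  have e3 : Gᶜ.pairCount {x', y'} {x, y} ≤ 4 :=
    (pairCount_le_card_mul _ _ _).trans (Nat.mul_le_mul card_le_two card_le_two)
  have e4 : Gᶜ.pairCount {x, y} B = Gᶜ.degIn B x + Gᶜ.degIn B y := sum_pair hxy.ne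
  have e5 : Gᶜ.pairCount {x', y'} A = Gᶜ.degIn A x' + Gᶜ.degIn A y' := sum_pair hxy'.ne
  have e6 := h.card_le_degIn_compl hxy (Finset.disjoint_left.1 hAB hx) (Finset.disjoint_left.1 hAB hy)
  have e7 := h.card_le_degIn_compl hxy' (Finset.disjoint_right.1 hAB hx') (Finset.disjoint_right.1 hAB hy')
  omega

end Partition

theorem exists_disjoint_edges_or_triangle [Nonempty V] (F : SimpleGraph V)
    (h : ∀ w, ∃ x y, F.Adj x y ∧ x ≠ w ∧ y ≠ w) :
    (∃ x y x' y', F.Adj x y ∧ F.Adj x' y' ∧ x ≠ x' ∧ x ≠ y' ∧ y ≠ x' ∧ y ≠ y') ∨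
      ∃ x y z, F.Adj x y ∧ F.Adj y z ∧ F.Adj x z := by
  obtain ⟨x, y, hxy, -⟩ := h (Classical.arbitrary V)
  obtain ⟨a, b, hab, ha, hb⟩ := h x
  obtain ⟨c, d, hcd, hc, hd⟩ := h y
  by_contra! hcon
  obtain ⟨h1, h2⟩ := hcon
  -- An edge avoiding `x` must meet `xy` at `y`, and one avoiding `y` must meet it at `x`. The
  -- resulting edges `yb` and `xd` are disjoint unless `b = d`, which closes a triangle.
  have e1 : y = a ∨ y = b := by
    by_contra! hh
    exact hh.2 (h1 x y a b hxy hab ha.symm hb.symm hh.1)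
  have e2 : x = c ∨ x = d := by
    by_contra! hh
    exact hd.symm (h1 x y c d hxy hcd hh.1 hh.2 hc.symm)
  wlog hya : y = a generalizing a b
  · exact this b a hab.symm hb ha e1.symm (e1.resolve_left hya)
  wlog hxc : x = c generalizing c d
  · exact this d c hcd.symm hd hc e2.symm (e2.resolve_left hxc)
  subst hya hxc
  by_cases hbd : b = d
  · subst hbd
    exact h2 x y b hxy hab hcd
  · exact hbd (h1 y b x d hab hcd hxy.ne' hd.symm hb)

theorem pairCount_self_add_degIn [DecidableEq V] (G : SimpleGraph V) {S : Finset V} {x : V} (hx : x ∉ S) :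
    G.pairCount (S ∪ {x}) (S ∪ {x}) = G.pairCount S S + 2 * G.degIn S x := by
  have hd : Disjoint S {x} := by simpa using hx
  rw [pairCount_union_left G hd, pairCount_union_right G hd, pairCount_union_right G hd,
    pairCount_comm G S {x}, pairCount_singleton_left, pairCount_singleton_left,
    G.degIn_eq_zero (S := {x}) (x := x) (by simp)]
  ring

section Cut

variable [Fintype V] [DecidableEq V]

/-- Let `B` be the neighbourhood of a vertex of maximum degree. The degrees over `Bᶜ` sum to at most
`|Bᶜ||B| ≤ n²/4`, and book-freeness bounds the pairs inside `B` by `r|B|`. -/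
theorem BookFree.exists_cut (h : G.BookFree r) :
    ∃ A : Finset V, 2 * (G.pairCount A A + G.pairCount Aᶜ Aᶜ) + 4 * G.edgeSet.ncard ≤
      Fintype.card V ^ 2 + 4 * r * Fintype.card V := by
  classical
  rcases isEmpty_or_nonempty V with hV | hV
  · refine ⟨∅, ?_⟩
    have : G.edgeSet.ncard = 0 := by
      have := two_mul_ncard_edgeSet G
      simp [pairCount] at this
      simp [this]
    rw [this]
    simp [pairCount]
  obtain ⟨v, -, hv⟩ := exists_max_image univ (G.degIn univ) univ_nonempty
  set B : Finset V := {y ∈ univ | G.Adj v y} with hB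
  have hBc : G.degIn univ v = #B := rfl
  refine ⟨Bᶜ, ?_⟩
  have h1 := two_mul_ncard_edgeSet_eq_of_compl G Bᶜ
  rw [compl_compl] at h1 ⊢
  have h2 : G.pairCount Bᶜ Bᶜ + G.pairCount Bᶜ B ≤ #Bᶜ * #B := by
    rw [← pairCount_union_right G disjoint_compl_left, union_comm,
      union_compl]
    have := sum_le_card_nsmul Bᶜ (G.degIn univ) #B (fun x _ => hBc ▸ hv x (mem_univ x))
    simpa [pairCount] using this
  have h3 : G.pairCount B B ≤ r * #B :=
    h.pairCount_le (w := v) (fun z hz => (mem_filter.1 hz).2) (fun z hz => (mem_filter.1 hz).2)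
  have h4 : #Bᶜ + #B = Fintype.card V := by rw [add_comm, card_add_card_compl]
  rw [← h4]
  have h5 : 4 * (#Bᶜ * #B) ≤ (#Bᶜ + #B) ^ 2 := by
    have := four_mul_le_sq_add #Bᶜ #B
    linarith
  have h6 : 4 * r * (#Bᶜ + #B) = 4 * (r * #Bᶜ) + 4 * (r * #B) := by ring
  rw [h6]
  omega

/-- Otherwise moving `x` across the cut would reduce the number of inner pairs. -/
theorem degIn_le_of_forall_cut_le (A : Finset V)
    (hA : ∀ A' : Finset V, G.pairCount A A + G.pairCount Aᶜ Aᶜ ≤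
      G.pairCount A' A' + G.pairCount A'ᶜ A'ᶜ) {x : V} (hx : x ∈ A) :
    G.degIn A x ≤ G.degIn Aᶜ x := by
  have h := hA (A.erase x)
  have e1 : A = A.erase x ∪ {x} := by ext; simp; grind
  have e2 : (A.erase x)ᶜ = Aᶜ ∪ {x} := by ext; simp
  have e3 : G.degIn A x = G.degIn (A.erase x) x := by
    conv_lhs => rw [e1]
    rw [degIn_union G (by simp), G.degIn_eq_zero (S := {x}) (by simp), add_zero]
  have e4 : G.pairCount A A = G.pairCount (A.erase x) (A.erase x) + 2 * G.degIn A x := by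
    rw [e3, ← pairCount_self_add_degIn G (by simp), ← e1]
  rw [e2, pairCount_self_add_degIn G (S := Aᶜ) (x := x) (by simpa using hx)] at h
  omega

end Cut

end SimpleGraph

end

/-! ### Stability: one vertex meets all the inner edges -/

section

open Finset

namespace SimpleGraph

/-- If `160sa > n`, then `m ≤ sn < 160s²a`, so `a < 160s² + s ≤ 161s²`. This bounds `160sa` by `160
· 161 s³ = 25760s³`, the source of the threshold on `n`. -/
theorem le_of_mul_self_le {s n m r a : ℕ} (hs : s = r + 1) (hn : 25760 * s ^ 3 ≤ n)
    (hm : m ≤ s * n) (h : a * a ≤ m + r * a) : 160 * s * a ≤ n := by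
  by_contra! hlt
  have ha : 0 < a := by
    rcases Nat.eq_zero_or_pos a with rfl | h
    · simp at hlt
    · exact h
  have h1 : a * a < (160 * s ^ 2 + s) * a := by
    have : s * n < s * (160 * s * a) := by
      apply Nat.mul_lt_mul_of_pos_left hlt; omega
    have : r * a ≤ s * a := Nat.mul_le_mul_right _ (by omega)
    nlinarith
  have h2 : a < 160 * s ^ 2 + s := lt_of_mul_lt_mul_right h1 (Nat.zero_le a)
  have h3 : 160 * s * a ≤ 160 * s * (160 * s ^ 2 + s) := Nat.mul_le_mul_left _ h2.le
  have h4 : 160 * s * (160 * s ^ 2 + s) ≤ 25760 * s ^ 3 := by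
    have : s ^ 2 ≤ s ^ 3 := Nat.pow_le_pow_right (by omega) (by norm_num)
    nlinarith
  omega

/-- Here `(b - a)² = n² - 4ab ≤ 4t ≤ (n/5)²`, so the parts differ by at most `n/5`. -/
theorem two_mul_le_five_mul {a b n t : ℕ} (hab : a + b = n) (h : n ^ 2 ≤ 4 * (a * b) + 4 * t)
    (ht : 100 * t ≤ n * n) : 2 * n ≤ 5 * a := by
  by_contra! hlt
  subst hab
  zify at *
  nlinarith [mul_pos (show (0 : ℤ) < 2 * (a + b) - 5 * a by linarith)
    (show (0 : ℤ) < 3 * b - 2 * a + a by linarith)]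

theorem twenty_mul_le {b r n K f m : ℕ} (hn : 0 < n) (hK : 160 * (r + 1) * K ≤ n)
    (hb : n ≤ 4 * (b - r)) (hm : m ≤ (r + 1) * n) (h : f * b ≤ 2 * K * m + r * f) :
    20 * f ≤ n := by
  obtain ⟨c, rfl⟩ : ∃ c, b = c + r := ⟨b - r, by omega⟩
  have h1 : f * c ≤ 2 * K * ((r + 1) * n) := by
    have h1 := Nat.mul_le_mul_left (2 * K) hm
    have h2 : f * (c + r) = f * c + r * f := by ring
    omega
  have h2 : f * n ≤ f * (4 * c) := Nat.mul_le_mul_left _ (by omega)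
  have h3 : 20 * f * n ≤ n * n := by
    have := Nat.mul_le_mul_right n hK
    linarith
  exact le_of_mul_le_mul_right h3 hn

/-- A `B_{r+1}`-free graph with almost as many edges as the extremal non-bipartite ones has a
vertex whose deletion leaves a bipartite graph. -/
theorem BookFree.exists_bipartite_delete {V : Type*} [Fintype V] {G : SimpleGraph V} {r n : ℕ}
    (h : G.BookFree r) (hV : Fintype.card V = n) (hn : 25760 * (r + 1) ^ 3 ≤ n)
    (he : n ^ 2 + 8 * r ≤ 4 * G.edgeSet.ncard + 2 * n) :
    ∃ (w : V) (A : Finset V), ∀ x y, G.Adj x y → x ≠ w → y ≠ w → (x ∈ A ↔ y ∉ A) := by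
  classical
  by_contra! hcon
  have hs3 : r + 1 ≤ (r + 1) ^ 3 := Nat.le_self_pow (by norm_num) _
  have hne : Nonempty V := Fintype.card_pos_iff.1 (by omega)
  obtain ⟨A₀, hA₀⟩ := h.exists_cut
  -- A global minimiser inherits the bound of the cut `A₀` and also resists single-vertex moves.
  obtain ⟨A, -, hA⟩ := exists_min_image univ
    (fun A : Finset V => G.pairCount A A + G.pairCount Aᶜ Aᶜ) univ_nonempty
  have hA₁ : ∀ A', G.pairCount A A + G.pairCount Aᶜ Aᶜ ≤ G.pairCount A' A' + G.pairCount A'ᶜ A'ᶜ :=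
    fun A' => hA A' (mem_univ _)
  obtain ⟨B, hB⟩ : ∃ B, B = Aᶜ := ⟨_, rfl⟩
  have hdA : ∀ x ∈ A, G.degIn A x ≤ G.degIn B x :=
    fun x hx => hB ▸ degIn_le_of_forall_cut_le A hA₁ hx
  have hdB : ∀ x ∈ B, G.degIn B x ≤ G.degIn A x := fun x hx => by
    have := degIn_le_of_forall_cut_le Aᶜ (fun A' => by
      rw [compl_compl, add_comm (G.pairCount Aᶜ Aᶜ)]; exact hA₁ A') (x := x) (hB ▸ hx)
    rwa [compl_compl, ← hB] at this
  have hAB : Disjoint A B := hB ▸ disjoint_compl_right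
  have hcard : #A + #B = n := by rw [hB, card_add_card_compl, hV]
  have hsum := two_mul_ncard_edgeSet_eq_of_compl G A
  have hf := hA₁ A₀
  rw [← hB] at hsum hf
  have hprod := G.pairCount_add_pairCount_compl hAB
  have hcomm : Gᶜ.pairCount B A = Gᶜ.pairCount A B := pairCount_comm _ _ _
  -- The triangle case is the weakest and gives the factor `3`. Disjoint edges give `4 * min #A #B`,
  -- and the error `4 * r + 8` comes from edges on opposite sides.
  have hfar : 2 * Gᶜ.pairCount A B + 4 * r + 8 ≥ 3 * min #A #B := by
    let F : SimpleGraph V :=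
      { Adj := fun x y => G.Adj x y ∧ (x ∈ A ↔ y ∈ A)
        symm := ⟨fun x y h => ⟨h.1.symm, h.2.symm⟩⟩
        loopless := ⟨fun x h => G.loopless.irrefl x h.1⟩ }
    have hmem : ∀ x, x ∉ A → x ∈ B := fun x hx => hB ▸ mem_compl.2 hx
    have hF := F.exists_disjoint_edges_or_triangle fun w => by
      obtain ⟨x, y, h1, h2, h3, h4⟩ := hcon w A
      exact ⟨x, y, ⟨h1, by tauto⟩, h2, h3⟩
    rcases hF with ⟨x, y, x', y', hxy, hxy', h1, h2, h3, h4⟩ | ⟨x, y, z, hxy, hyz, hxz⟩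
    · by_cases hx : x ∈ A <;> by_cases hx' : x' ∈ A
      · have := h.two_mul_card_le hAB hx (hxy.2.1 hx) hx' (hxy'.2.1 hx') hxy.1 hxy'.1 h1 h2 h3 h4
        omega
      · have := h.card_add_card_le hAB hx (hxy.2.1 hx) (hmem _ hx')
          (hmem _ fun hy => hx' (hxy'.2.2 hy)) hxy.1 hxy'.1
        omega
      · have := h.card_add_card_le hAB hx' (hxy'.2.1 hx') (hmem _ hx)
          (hmem _ fun hy => hx (hxy.2.2 hy)) hxy'.1 hxy.1
        omega
      · have := h.two_mul_card_le hAB.symm (hmem _ hx) (hmem _ fun hy => hx (hxy.2.2 hy))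
          (hmem _ hx') (hmem _ fun hy => hx' (hxy'.2.2 hy)) hxy.1 hxy'.1 h1 h2 h3 h4
        omega
    · by_cases hx : x ∈ A
      · have := h.three_mul_card_le hAB hx (hxy.2.1 hx) (hxz.2.1 hx) hxy.1 hyz.1 hxz.1
        omega
      · have := h.three_mul_card_le hAB.symm (hmem _ hx) (hmem _ fun hy => hx (hxy.2.2 hy))
          (hmem _ fun hz => hx (hxz.2.2 hz)) hxy.1 hyz.1 hxz.1
        omega
  have hfn : G.pairCount A A + G.pairCount B B + n ≤ 2 * ((r + 1) * n) := by
    rw [hV] at hA₀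
    have : 4 * r * n = 4 * (r * n) := by ring
    have : (r + 1) * n = r * n + n := by ring
    omega
  have hsq : 4 * (#A * #B) ≤ n ^ 2 := by
    have := four_mul_le_sq_add #A #B
    rw [hcard] at this
    linarith
  have hm : Gᶜ.pairCount A B ≤ (r + 1) * n := by omega
  have hm' : 2 * Gᶜ.pairCount A B ≤ n + (G.pairCount A A + G.pairCount B B) := by omega
  have hK : ∀ x, (x ∈ A → 160 * (r + 1) * G.degIn A x ≤ n) ∧
      (x ∈ B → 160 * (r + 1) * G.degIn B x ≤ n) := fun x =>
    ⟨fun hx => le_of_mul_self_le rfl hn hm (h.degIn_mul_self_le hAB (hdA x hx)),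
      fun hx => le_of_mul_self_le rfl hn hm (hcomm ▸ h.degIn_mul_self_le hAB.symm (hdB x hx))⟩
  have hmin : 2 * n ≤ 5 * min #A #B := by
    have h4 : n ^ 2 ≤ 4 * (#A * #B) + 4 * ((r + 1) * n) := by
      have : (r + 1) * n = r * n + n := by ring
      omega
    have hn' : 100 * (r + 1) ≤ n := by omega
    have h5 : 100 * ((r + 1) * n) ≤ n * n := by nlinarith
    rcases le_total #A #B with hle | hle
    · rw [min_eq_left hle]
      exact two_mul_le_five_mul hcard h4 h5
    · rw [min_eq_right hle]
      exact two_mul_le_five_mul (by rw [add_comm, hcard]) (by rwa [mul_comm #B]) h5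
  -- With inner degrees at most `K ≤ n / (160(r + 1))`, the linear bound on inner pairs improves to
  -- `n/20` on each side.
  have hside : ∀ f b K : ℕ, 160 * (r + 1) * K ≤ n → min #A #B ≤ b →
      f * b ≤ 2 * K * Gᶜ.pairCount A B + r * f → 20 * f ≤ n := by
    intro f b K hK hb hfb
    have hb' : n ≤ 4 * (b - r) := by omega
    exact twenty_mul_le (by omega) hK hb' hm hfb
  have hfA : 20 * G.pairCount A A ≤ n := by
    refine hside _ #B (n / (160 * (r + 1))) (Nat.mul_div_le _ _) (min_le_right _ _)
      (h.pairCount_self_mul_card_le hAB fun x hx => ?_)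
    rw [Nat.le_div_iff_mul_le (by omega), mul_comm]
    exact (hK x).1 hx
  have hfB : 20 * G.pairCount B B ≤ n := by
    refine hside _ #A (n / (160 * (r + 1))) (Nat.mul_div_le _ _) (min_le_left _ _)
      (hcomm ▸ h.pairCount_self_mul_card_le hAB.symm fun x hx => ?_)
    rw [Nat.le_div_iff_mul_le (by omega), mul_comm]
    exact (hK x).2 hx
  -- Twice the missing pairs is at most `n + n/10`, while `hfar` and `hmin` require at least `6n/5 -
  -- 4r - 8`.
  omega

end SimpleGraph

end

/-! ### Bipartite graphs with one additional vertex: the exact edge bound -/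

section

open Finset

namespace SimpleGraph

variable {V : Type*} {G : SimpleGraph V} {r : ℕ}

/-- The vertices other than `w` are partitioned into independent sets `X` and `Y`, in which `w`
has the neighbourhoods `P` and `Q`. -/
structure IsVertexSplit (G : SimpleGraph V) (w : V) (X Y P Q : Finset V) : Prop where
  not_adj_left : ∀ x ∈ X, ∀ y ∈ X, ¬ G.Adj x y
  not_adj_right : ∀ x ∈ Y, ∀ y ∈ Y, ¬ G.Adj x y
  cover : ∀ z, z = w ∨ z ∈ X ∨ z ∈ Y
  disjoint : Disjoint X Y
  notMem_left : w ∉ X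
  notMem_right : w ∉ Y
  mem_P : ∀ z, z ∈ P ↔ z ∈ X ∧ G.Adj w z
  mem_Q : ∀ z, z ∈ Q ↔ z ∈ Y ∧ G.Adj w z

namespace IsVertexSplit

variable {w : V} {X Y P Q : Finset V}

theorem swap (h : G.IsVertexSplit w X Y P Q) : G.IsVertexSplit w Y X Q P :=
  ⟨h.not_adj_right, h.not_adj_left, fun z => by have := h.cover z; tauto, h.disjoint.symm,
    h.notMem_right, h.notMem_left, h.mem_Q, h.mem_P⟩

theorem P_subset (h : G.IsVertexSplit w X Y P Q) : P ⊆ X := fun z hz => ((h.mem_P z).1 hz).1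

theorem Q_subset (h : G.IsVertexSplit w X Y P Q) : Q ⊆ Y := fun z hz => ((h.mem_Q z).1 hz).1

theorem degIn_left (h : G.IsVertexSplit w X Y P Q) : G.degIn X w = #P := by
  classical
  rw [degIn_eq_card]
  congr 1
  ext z
  rw [mem_filter, h.mem_P]

theorem card_add_card [Fintype V] (h : G.IsVertexSplit w X Y P Q) :
    #X + #Y + 1 = Fintype.card V := by
  classical
  have hu : univ = insert w (X ∪ Y) := by
    ext z
    simpa using h.cover z
  rw [← card_univ, hu, card_insert_of_notMem (by simp [h.notMem_left, h.notMem_right]),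
    card_union_of_disjoint h.disjoint]

theorem ncard_edgeSet [Fintype V] (h : G.IsVertexSplit w X Y P Q) :
    G.edgeSet.ncard = G.pairCount X Y + #P + #Q := by
  classical
  have hu : univ = (X ∪ Y) ∪ {w} := by
    ext z
    simpa [or_comm] using h.cover z
  have hX : G.pairCount X X = 0 := sum_eq_zero fun x hx => degIn_eq_zero (h.not_adj_left x hx)
  have hY : G.pairCount Y Y = 0 := sum_eq_zero fun x hx => degIn_eq_zero (h.not_adj_right x hx)
  have h2 := two_mul_ncard_edgeSet G
  rw [hu, pairCount_self_add_degIn G (by simp [h.notMem_left, h.notMem_right]),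
    pairCount_union_left G h.disjoint, pairCount_union_right G h.disjoint,
    pairCount_union_right G h.disjoint, degIn_union G h.disjoint, h.degIn_left, h.swap.degIn_left,
    hX, hY, pairCount_comm G Y X] at h2
  omega

/-- A triangle must contain `w`. An edge avoiding `w` is therefore in at most one triangle, which is
where `1 ≤ r` enters, and an edge from `w` to `P` has its common neighbours in `Q`. -/
theorem bookFree (h : G.IsVertexSplit w X Y P Q) (hr : 1 ≤ r)
    (hP : ∀ p ∈ P, G.degIn Q p ≤ r) (hQ : ∀ q ∈ Q, G.degIn P q ≤ r) : G.BookFree r := by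
  classical
  have key : ∀ {X Y P Q : Finset V}, G.IsVertexSplit w X Y P Q → (∀ p ∈ P, G.degIn Q p ≤ r) →
      ∀ u ∈ X, G.Adj u w → (G.commonNeighbors u w).ncard ≤ r := by
    intro X Y P Q h hP u hu huw
    refine le_trans ?_ (hP u ((h.mem_P u).2 ⟨hu, huw.symm⟩))
    rw [degIn, ← Set.ncard_coe_finset]
    refine Set.ncard_le_ncard ?_ (Finset.finite_toSet _)
    rintro z ⟨hz1, hz2⟩
    rw [mem_coe, mem_filter, h.mem_Q]
    rcases h.cover z with rfl | hz | hz
    · exact absurd hz2 (G.loopless.irrefl _)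
    · exact absurd hz1 (h.not_adj_left u hu z hz)
    · exact ⟨⟨hz, hz2⟩, hz1⟩
  have key' : ∀ u, G.Adj u w → (G.commonNeighbors u w).ncard ≤ r := by
    intro u huw
    rcases h.cover u with rfl | hu | hu
    · exact absurd huw (G.loopless.irrefl _)
    · exact key h hP u hu huw
    · exact key h.swap hQ u hu huw
  intro u v huv
  by_cases hv : v = w
  · exact hv ▸ key' u (hv ▸ huv)
  by_cases hu : u = w
  · rw [commonNeighbors_symm]
    exact hu ▸ key' v (hu ▸ huv.symm)
  refine le_trans ?_ hr
  rw [← Set.ncard_singleton w]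
  refine Set.ncard_le_ncard ?_ (Set.finite_singleton w)
  rintro z ⟨hz1, hz2⟩
  rw [mem_neighborSet] at hz1 hz2
  rw [Set.mem_singleton_iff]
  have hu' := (h.cover u).resolve_left hu
  have hv' := (h.cover v).resolve_left hv
  rcases h.cover z with hz | hz | hz
  · exact hz
  · have h1 := fun hx => h.not_adj_left u hx z hz hz1
    have h2 := fun hx => h.not_adj_left v hx z hz hz2
    exact absurd huv (h.not_adj_right u (hu'.resolve_left h1) v (hv'.resolve_left h2))
  · have h1 := fun hx => h.not_adj_right u hx z hz hz1
    have h2 := fun hx => h.not_adj_right v hx z hz hz2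
    exact absurd huv (h.not_adj_left u (hu'.resolve_right h1) v (hv'.resolve_right h2))

/-- If `w` had no neighbour in `X`, then `X ∪ {w}` and `Y` would be colour classes. -/
theorem nonempty_of_not_isBipartite (h : G.IsVertexSplit w X Y P Q) (hG : ¬ G.IsBipartite) :
    P.Nonempty := by
  classical
  by_contra hP
  rw [not_nonempty_iff_eq_empty] at hP
  have hw : ∀ z ∈ X, ¬ G.Adj w z := fun z hz hwz => by
    have := (h.mem_P z).2 ⟨hz, hwz⟩
    simp [hP] at this
  refine hG ⟨Coloring.mk (fun z => if z ∈ Y then (0 : Fin 2) else 1) ?_⟩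
  intro u v huv
  have h1 := h.not_adj_left u
  have h2 := h.not_adj_right u
  by_cases hu : u ∈ Y <;> by_cases hv : v ∈ Y <;> simp [hu, hv]
  · exact h2 hu v hv huv
  · rcases h.cover u with rfl | hu' | hu'
    · rcases h.cover v with rfl | hv' | hv'
      · exact G.loopless.irrefl _ huv
      · exact hw v hv' huv
      · exact hv hv'
    · rcases h.cover v with rfl | hv' | hv'
      · exact hw u hu' huv.symm
      · exact h1 hu' v hv' huv
      · exact hv hv'
    · exact hu hu'

theorem card_mul_card_le [Fintype V] (h : G.IsVertexSplit w X Y P Q) :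
    #X * #Y ≤ (Fintype.card V - 1) ^ 2 / 4 := by
  rw [← h.card_add_card, Nat.add_sub_cancel, Nat.le_div_iff_mul_le (by norm_num)]
  have := four_mul_le_sq_add #X #Y
  linarith

/-- The hypothesis says that all missing pairs already lie in `P × Q`; a non-neighbour in `Y` of
some `x ∉ P` would be an extra one. -/
theorem adj_of_pairCount_compl_le (h : G.IsVertexSplit w X Y P Q)
    (hPQ : Gᶜ.pairCount X Y ≤ Gᶜ.pairCount P Q) :
    ∀ x ∈ X, ∀ y ∈ Y, x ∉ P → G.Adj x y := by
  classical
  intro x hx y hy hxP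
  by_contra hxy
  have h1 : Gᶜ.pairCount (P ∪ {x}) Y ≤ Gᶜ.pairCount X Y :=
    pairCount_mono _ (union_subset h.P_subset (by simpa using hx)) Subset.rfl
  rw [pairCount_union_left _ (by simpa using hxP), pairCount_singleton_left] at h1
  have h2 : Gᶜ.pairCount P Q ≤ Gᶜ.pairCount P Y := pairCount_mono _ Subset.rfl h.Q_subset
  have h3 : 0 < Gᶜ.degIn Y x := by
    rw [degIn_eq_card, card_pos]
    refine ⟨y, mem_filter.2 ⟨hy, ?_⟩⟩
    rw [compl_adj]
    exact ⟨fun e => Finset.disjoint_left.1 h.disjoint hx (e ▸ hy), hxy⟩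
  omega

end IsVertexSplit

/-- Take `a ≤ b`. If `b ≤ r`, use `e ≤ ab`. If `b > r`, use `e ≤ ra`; the slack is then at least `(a
- 1)(b - r - 1) + (r - 1)`, which vanishes only for `r = 1` and `a = 1` or `b = 2`. -/
theorem add_add_le_two_mul_add_mul {a b e r : ℕ} (hr : 1 ≤ r) (ha : 1 ≤ a) (hb : 1 ≤ b)
    (hea : e ≤ r * a) (heb : e ≤ r * b) (he : e ≤ a * b) :
    a + b + e ≤ 2 * r + a * b ∧ (a + b + e = 2 * r + a * b →
      (a = r ∧ b = r ∧ e = a * b) ∨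
      (r = 1 ∧ ((a = 1 ∨ b = 1) ∧ e = 1 ∨ a = 2 ∧ b = 2 ∧ e = 2))) := by
  wlog hab : a ≤ b generalizing a b
  · have := this hb ha heb hea (by rwa [mul_comm]) (by omega)
    rw [add_comm b a, mul_comm b a] at this
    refine ⟨this.1, fun h => ?_⟩
    have := this.2 h
    tauto
  rcases Nat.lt_or_ge r b with hrb | hrb
  · obtain ⟨c, rfl⟩ : ∃ c, b = r + 1 + c := ⟨b - (r + 1), by omega⟩
    rcases Nat.lt_or_ge 1 a with ha1 | ha1
    · have h1 : a * (r + 1 + c) = r * a + a + a * c := by ring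
      have h2 : 2 * c ≤ a * c := Nat.mul_le_mul_right _ ha1
      refine ⟨by omega, fun h => Or.inr ?_⟩
      have hc : c = 0 := by omega
      subst hc
      have hr1 : r = 1 := by omega
      subst hr1
      omega
    · have : a = 1 := by omega
      subst this
      refine ⟨by omega, fun h => Or.inr ?_⟩
      omega
  · refine ⟨by omega, fun h => Or.inl ?_⟩
    omega

namespace IsVertexSplit

variable {w : V} {X Y P Q : Finset V}

theorem ncard_edgeSet_le [Fintype V] (h : G.IsVertexSplit w X Y P Q) (hG : ¬ G.IsBipartite)
    (hr : 1 ≤ r) (hB : G.BookFree r) :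
    G.edgeSet.ncard ≤ (Fintype.card V - 1) ^ 2 / 4 + 2 * r ∧
    (G.edgeSet.ncard = (Fintype.card V - 1) ^ 2 / 4 + 2 * r →
      #X * #Y = (Fintype.card V - 1) ^ 2 / 4 ∧
      (∀ x ∈ X, ∀ y ∈ Y, x ∉ P ∨ y ∉ Q → G.Adj x y) ∧
      ((#P = r ∧ #Q = r ∧ G.pairCount P Q = #P * #Q) ∨
        (r = 1 ∧ ((#P = 1 ∨ #Q = 1) ∧ G.pairCount P Q = 1 ∨
          #P = 2 ∧ #Q = 2 ∧ G.pairCount P Q = 2)))) := by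
  have hwP : ∀ z ∈ P, G.Adj w z := fun z hz => ((h.mem_P z).1 hz).2
  have hwQ : ∀ z ∈ Q, G.Adj w z := fun z hz => ((h.mem_Q z).1 hz).2
  obtain ⟨h1, h2⟩ := add_add_le_two_mul_add_mul hr (h.nonempty_of_not_isBipartite hG).card_pos
    (h.swap.nonempty_of_not_isBipartite hG).card_pos (hB.pairCount_le hwP hwQ)
    (pairCount_comm G P Q ▸ hB.pairCount_le hwQ hwP) (G.pairCount_le_card_mul P Q)
  have h3 := h.ncard_edgeSet
  have h4 := h.card_mul_card_le
  have h5 := G.pairCount_add_pairCount_compl h.disjoint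
  have h6 := G.pairCount_add_pairCount_compl (h.disjoint.mono h.P_subset h.Q_subset)
  have h7 : Gᶜ.pairCount P Q ≤ Gᶜ.pairCount X Y := pairCount_mono _ h.P_subset h.Q_subset
  refine ⟨by omega, fun he => ⟨by omega, fun x hx y hy hxy => ?_, h2 (by omega)⟩⟩
  have h8 : Gᶜ.pairCount X Y ≤ Gᶜ.pairCount P Q := by omega
  rcases hxy with hxP | hyQ
  · exact h.adj_of_pairCount_compl_le h8 x hx y hy hxP
  · rw [pairCount_comm, pairCount_comm Gᶜ P] at h8
    exact (h.swap.adj_of_pairCount_compl_le h8 y hy x hx hyQ).symm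

end IsVertexSplit

open Classical in
theorem exists_isVertexSplit [Fintype V] (G : SimpleGraph V) {w : V} {A : Finset V}
    (h : ∀ x y, G.Adj x y → x ≠ w → y ≠ w → (x ∈ A ↔ y ∉ A)) :
    ∃ X Y P Q, G.IsVertexSplit w X Y P Q := by
  refine ⟨A.erase w, Aᶜ.erase w, {z ∈ A.erase w | G.Adj w z}, {z ∈ Aᶜ.erase w | G.Adj w z},
    ?_, ?_, ?_, ?_, ?_, ?_, ?_, ?_⟩
  · intro x hx y hy hxy
    rw [mem_erase] at hx hy
    exact (h x y hxy hx.1 hy.1).1 hx.2 hy.2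
  · intro x hx y hy hxy
    rw [mem_erase, mem_compl] at hx hy
    exact hx.2 ((h x y hxy hx.1 hy.1).2 hy.2)
  · intro z
    simp only [mem_erase, mem_compl]
    tauto
  · exact disjoint_compl_right.mono (erase_subset _ _) (erase_subset _ _)
  · simp
  · simp
  · intro z
    rw [mem_filter]
  · intro z
    rw [mem_filter]

end SimpleGraph

end

/-! ### The two extremal constructions -/

section

open Finset

namespace SimpleGraph

theorem mul_eq_sq_div_four {s t : ℕ} (h1 : s ≤ t + 1) (h2 : t ≤ s + 1) :
    s * t = (s + t) ^ 2 / 4 := by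
  have h : s = t ∨ s = t + 1 ∨ t = s + 1 := by omega
  rcases h with rfl | rfl | rfl
  · have : (s + s) ^ 2 = 4 * (s * s) := by ring
    omega
  · have : (t + 1 + t) ^ 2 = 4 * ((t + 1) * t) + 1 := by ring
    omega
  · have : (s + (s + 1)) ^ 2 = 4 * (s * (s + 1)) + 1 := by ring
    omega

/-- Since `(s + t)² - 4st = (s - t)²`, a difference of two or more loses at least one after division
by `4`. -/
theorem le_add_one_of_mul_eq {s t : ℕ} (h : s * t = (s + t) ^ 2 / 4) : s ≤ t + 1 := by
  by_contra! hlt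
  obtain ⟨c, rfl⟩ : ∃ c, s = t + 2 + c := ⟨s - (t + 2), by omega⟩
  have h1 : (t + 2 + c + t) ^ 2 = 4 * ((t + 2 + c) * t) + (c + 2) ^ 2 := by ring
  have h2 : 4 ≤ (c + 2) ^ 2 := by nlinarith
  omega

variable {V W : Type*} {G : SimpleGraph V} {H : SimpleGraph W}

theorem not_isBipartite_of_triangle {a b c : V} (hab : G.Adj a b) (hbc : G.Adj b c)
    (hac : G.Adj a c) : ¬ G.IsBipartite := by
  rintro ⟨C⟩
  have h1 := C.valid hab
  have h2 := C.valid hbc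
  have h3 := C.valid hac
  generalize C a = x at *
  generalize C b = y at *
  generalize C c = z at *
  revert x y z
  decide

theorem Iso.not_isBipartite (e : G ≃g H) (h : ¬ H.IsBipartite) : ¬ G.IsBipartite :=
  fun hG => h (Colorable.of_hom e.symm.toHom hG)

theorem Iso.ncard_edgeSet (e : G ≃g H) : G.edgeSet.ncard = H.edgeSet.ncard := by
  rw [← Nat.card_coe_set_eq, ← Nat.card_coe_set_eq]
  exact Nat.card_congr e.mapEdgeSet

theorem nonempty_iso_of_bijective {f : W → V} (hi : Function.Injective f)
    (hs : Function.Surjective f) (hf : ∀ x y, G.Adj (f x) (f y) ↔ H.Adj x y) :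
    Nonempty (G ≃g H) :=
  ⟨(⟨Equiv.ofBijective f ⟨hi, hs⟩, hf _ _⟩ : H ≃g G).symm⟩

section bipartitePlusVertex

variable {r s t : ℕ}

@[simp] theorem bipartitePlusVertex_adj_inl_inl (i i' : Fin s) :
    ¬ (bipartitePlusVertex r s t).Adj (some (.inl i)) (some (.inl i')) := by
  simp [bipartitePlusVertex]

@[simp] theorem bipartitePlusVertex_adj_inr_inr (j j' : Fin t) :
    ¬ (bipartitePlusVertex r s t).Adj (some (.inr j)) (some (.inr j')) := by
  simp [bipartitePlusVertex]

@[simp] theorem bipartitePlusVertex_adj_inl_inr (i : Fin s) (j : Fin t) :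
    (bipartitePlusVertex r s t).Adj (some (.inl i)) (some (.inr j)) := by
  simp [bipartitePlusVertex]

@[simp] theorem bipartitePlusVertex_adj_inr_inl (j : Fin t) (i : Fin s) :
    (bipartitePlusVertex r s t).Adj (some (.inr j)) (some (.inl i)) := by
  simp [bipartitePlusVertex]

@[simp] theorem bipartitePlusVertex_adj_none_inl (i : Fin s) :
    (bipartitePlusVertex r s t).Adj none (some (.inl i)) ↔ i.val < r := by
  simp [bipartitePlusVertex]

@[simp] theorem bipartitePlusVertex_adj_none_inr (j : Fin t) :
    (bipartitePlusVertex r s t).Adj none (some (.inr j)) ↔ j.val < r := by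
  simp [bipartitePlusVertex]

@[simp] theorem bipartitePlusVertex_adj_inl_none (i : Fin s) :
    (bipartitePlusVertex r s t).Adj (some (.inl i)) none ↔ i.val < r := by
  simp [bipartitePlusVertex]

@[simp] theorem bipartitePlusVertex_adj_inr_none (j : Fin t) :
    (bipartitePlusVertex r s t).Adj (some (.inr j)) none ↔ j.val < r := by
  simp [bipartitePlusVertex]

theorem bipartitePlusVertex_isVertexSplit :
    (bipartitePlusVertex r s t).IsVertexSplit none
      (univ.image fun i => some (.inl i)) (univ.image fun j => some (.inr j))
      (({i | i.val < r} : Finset (Fin s)).image (fun i => some (.inl i)))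
      (({j | j.val < r} : Finset (Fin t)).image (fun j => some (.inr j))) := by
  refine ⟨?_, ?_, ?_, ?_, ?_, ?_, ?_, ?_⟩
  · simp
  · simp
  · rintro (_ | i | j) <;> simp
  · rw [Finset.disjoint_left]
    rintro (_ | i | j) <;> simp
  · simp
  · simp
  · rintro (_ | i | j) <;> simp
  · rintro (_ | i | j) <;> simp

theorem card_filter_val_lt {r s : ℕ} (h : r ≤ s) : #{i : Fin s | i.val < r} = r := by
  rw [Fin.card_filter_val_lt, min_eq_right h]

theorem bipartitePlusVertex_bookFree (hr : 1 ≤ r) (hs : r ≤ s) (ht : r ≤ t) :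
    (bipartitePlusVertex r s t).BookFree r := by
  refine bipartitePlusVertex_isVertexSplit.bookFree hr (fun p _ => ?_) (fun q _ => ?_)
  · refine (degIn_le_card _ _ _).trans (card_image_le.trans (card_filter_val_lt ht).le)
  · refine (degIn_le_card _ _ _).trans (card_image_le.trans (card_filter_val_lt hs).le)

theorem bipartitePlusVertex_not_isBipartite (hr : 1 ≤ r) (hs : r ≤ s) (ht : r ≤ t) :
    ¬ (bipartitePlusVertex r s t).IsBipartite :=
  not_isBipartite_of_triangle (a := none) (b := some (.inl ⟨0, by omega⟩))
    (c := some (.inr ⟨0, by omega⟩)) (by simp; omega) (by simp) (by simp; omega)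

theorem bipartitePlusVertex_ncard_edgeSet (hs : r ≤ s) (ht : r ≤ t) :
    (bipartitePlusVertex r s t).edgeSet.ncard = s * t + 2 * r := by
  have hi : Function.Injective fun i : Fin s => (some (.inl i) : Option (Fin s ⊕ Fin t)) :=
    fun i j h => by simpa using h
  have hj : Function.Injective fun i : Fin t => (some (.inr i) : Option (Fin s ⊕ Fin t)) :=
    fun i j h => by simpa using h
  classical
  rw [bipartitePlusVertex_isVertexSplit.ncard_edgeSet, card_image_of_injective _ hi,
    card_image_of_injective _ hj, card_filter_val_lt hs, card_filter_val_lt ht,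
    pairCount_eq_sum, sum_image hi.injOn]
  simp only [sum_image hj.injOn]
  simp
  ring

/-- `bipartitePlusVertex` joins the new vertex to the first `r` indices, so the enumeration of `X`
has to list `P` first. -/
theorem exists_equiv_fin {α : Type*} {X P : Finset α} (hP : P ⊆ X) (hX : #X = s) (hr : #P = r) :
    ∃ e : Fin s ≃ X, ∀ i, (e i : α) ∈ P ↔ i.val < r := by
  classical
  let e₀ : Fin s ≃ X := (X.equivFinOfCardEq hX).symm
  have hc : Fintype.card {i : Fin s // i.val < r} = Fintype.card {i // (e₀ i : α) ∈ P} := by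
    rw [Fintype.card_subtype, card_filter_val_lt (by rw [← hr, ← hX]; exact card_le_card hP),
      ← hr, ← Fintype.card_coe]
    refine Fintype.card_congr ⟨fun x => ⟨e₀.symm ⟨x, hP x.2⟩, by simp⟩, fun i => ⟨e₀ i, i.2⟩,
      fun x => by simp, fun i => by simp⟩
  let e₁ := Fintype.equivOfCardEq hc
  refine ⟨e₁.extendSubtype.trans e₀, fun i => ⟨fun h => ?_, fun h => e₁.extendSubtype_mem i h⟩⟩
  by_contra hi
  exact e₁.extendSubtype_not_mem i hi h

theorem IsVertexSplit.nonempty_iso_bipartitePlusVertex {w : V} {X Y P Q : Finset V}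
    (h : G.IsVertexSplit w X Y P Q) (hX : #X = s) (hY : #Y = t) (hP : #P = r) (hQ : #Q = r)
    (hadj : ∀ x ∈ X, ∀ y ∈ Y, G.Adj x y) : Nonempty (G ≃g bipartitePlusVertex r s t) := by
  obtain ⟨e, he⟩ := exists_equiv_fin h.P_subset hX hP
  obtain ⟨e', he'⟩ := exists_equiv_fin h.Q_subset hY hQ
  have hw : ∀ i, G.Adj w (e i) ↔ i.val < r := fun i => by
    rw [← he, h.mem_P]
    simp
  have hw' : ∀ i, G.Adj w (e' i) ↔ i.val < r := fun i => by
    rw [← he', h.mem_Q]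
    simp
  have hd : ∀ i j, (e i : V) ≠ e' j := fun i j hij =>
    Finset.disjoint_left.1 h.disjoint (e i).2 (hij ▸ (e' j).2)
  have hwe : ∀ i, (e i : V) ≠ w := fun i hi => h.notMem_left (hi ▸ (e i).2)
  have hwe' : ∀ i, (e' i : V) ≠ w := fun i hi => h.notMem_right (hi ▸ (e' i).2)
  let f : Option (Fin s ⊕ Fin t) → V := fun
    | none => w
    | some (.inl i) => e i
    | some (.inr j) => e' j
  refine nonempty_iso_of_bijective (f := f) ?_ ?_ ?_
  · rintro (_ | i | i) (_ | j | j) hij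
    · rfl
    · exact absurd hij (hwe j).symm
    · exact absurd hij (hwe' j).symm
    · exact absurd hij (hwe i)
    · rw [e.injective (Subtype.ext hij)]
    · exact absurd hij (hd i j)
    · exact absurd hij (hwe' i)
    · exact absurd hij (hd j i).symm
    · rw [e'.injective (Subtype.ext hij)]
  · intro z
    rcases h.cover z with rfl | hz | hz
    · exact ⟨none, rfl⟩
    · exact ⟨some (.inl (e.symm ⟨z, hz⟩)), by simp [f]⟩
    · exact ⟨some (.inr (e'.symm ⟨z, hz⟩)), by simp [f]⟩
  · have h1 : ∀ i j, G.Adj (e i) (e' j) := fun i j => hadj _ (e i).2 _ (e' j).2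
    have h2 : ∀ i j, ¬ G.Adj (e i) (e j) := fun i j => h.not_adj_left _ (e i).2 _ (e j).2
    have h3 : ∀ i j, ¬ G.Adj (e' i) (e' j) := fun i j => h.not_adj_right _ (e' i).2 _ (e' j).2
    rintro (_ | i | i) (_ | j | j) <;>
      simp [f, h1, h2, h3, hw, hw', G.adj_comm _ w, (h1 _ _).symm]

end bipartitePlusVertex

section triangleAttachment

variable {S T : Type*} {S₁ : Set S} {T₁ : Set T}

@[simp] theorem triangleAttachment_adj_inl_inl (i i' : S) :
    ¬ (triangleAttachment S₁ T₁).Adj (.inl (.inl i)) (.inl (.inl i')) := by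
  simp [triangleAttachment]

@[simp] theorem triangleAttachment_adj_inr_inr (j j' : T) :
    ¬ (triangleAttachment S₁ T₁).Adj (.inl (.inr j)) (.inl (.inr j')) := by
  simp [triangleAttachment]

@[simp] theorem triangleAttachment_adj_inl_inr (i : S) (j : T) :
    (triangleAttachment S₁ T₁).Adj (.inl (.inl i)) (.inl (.inr j)) := by
  simp [triangleAttachment]

@[simp] theorem triangleAttachment_adj_inr_inl (j : T) (i : S) :
    (triangleAttachment S₁ T₁).Adj (.inl (.inr j)) (.inl (.inl i)) := by
  simp [triangleAttachment]

@[simp] theorem triangleAttachment_adj_triangle (a b : Fin 3) :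
    (triangleAttachment S₁ T₁).Adj (.inr a) (.inr b) ↔ a ≠ b := by
  simp [triangleAttachment]

@[simp] theorem triangleAttachment_adj_triangle_inl (a : Fin 3) (i : S) :
    (triangleAttachment S₁ T₁).Adj (.inr a) (.inl (.inl i)) ↔
      (a = 0 ∧ i ∉ S₁) ∨ (a = 2 ∧ i ∈ S₁) := by
  simp [triangleAttachment]

@[simp] theorem triangleAttachment_adj_triangle_inr (a : Fin 3) (j : T) :
    (triangleAttachment S₁ T₁).Adj (.inr a) (.inl (.inr j)) ↔
      (a = 1 ∧ j ∉ T₁) ∨ (a = 2 ∧ j ∈ T₁) := by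
  simp [triangleAttachment]

@[simp] theorem triangleAttachment_adj_inl_triangle (a : Fin 3) (i : S) :
    (triangleAttachment S₁ T₁).Adj (.inl (.inl i)) (.inr a) ↔
      (a = 0 ∧ i ∉ S₁) ∨ (a = 2 ∧ i ∈ S₁) := by
  simp [triangleAttachment]

@[simp] theorem triangleAttachment_adj_inr_triangle (a : Fin 3) (j : T) :
    (triangleAttachment S₁ T₁).Adj (.inl (.inr j)) (.inr a) ↔
      (a = 1 ∧ j ∉ T₁) ∨ (a = 2 ∧ j ∈ T₁) := by
  simp [triangleAttachment]

theorem triangleAttachment_not_isBipartite : ¬ (triangleAttachment S₁ T₁).IsBipartite :=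
  not_isBipartite_of_triangle (a := .inr 0) (b := .inr 1) (c := .inr 2) (by simp) (by simp)
    (by simp)

variable [Fintype S] [Fintype T]

open Classical in
-- The special vertex is `w₃`; `w₂` joins the side of `S` and `w₁` the side of `T`, since each is
-- adjacent only to the opposite part.
theorem triangleAttachment_isVertexSplit :
    (triangleAttachment S₁ T₁).IsVertexSplit (.inr 2)
      (insert (.inr 1) (univ.image fun i => .inl (.inl i)))
      (insert (.inr 0) (univ.image fun j => .inl (.inr j)))
      (insert (.inr 1) (S₁.toFinset.image fun i => .inl (.inl i)))
      (insert (.inr 0) (T₁.toFinset.image fun j => .inl (.inr j))) := by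
  refine ⟨?_, ?_, ?_, ?_, ?_, ?_, ?_, ?_⟩
  · simp
  · simp
  · rintro ((i | j) | a)
    · simp
    · simp
    · fin_cases a <;> simp
  · rw [Finset.disjoint_left]
    rintro ((i | j) | a) <;> simp
    rintro rfl
    simp
  · simp
  · simp
  · rintro ((i | j) | a) <;> simp
    rintro rfl
    simp
  · rintro ((i | j) | a) <;> simp
    rintro rfl
    simp

theorem triangleAttachment_bookFree (h : S₁.ncard * T₁.ncard ≤ 1) :
    (triangleAttachment S₁ T₁).BookFree 1 := by
  classical
  have hS : ∀ i ∈ S₁, ∀ a b, a ∈ T₁ → b ∈ T₁ → a = b := fun i hi => by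
    have : 0 < S₁.ncard := (Set.ncard_pos (Set.toFinite _)).2 ⟨i, hi⟩
    have hle : T₁.ncard ≤ 1 := by nlinarith
    exact fun a b => (Set.ncard_le_one_iff (Set.toFinite _)).1 hle
  have hT : ∀ j ∈ T₁, ∀ a b, a ∈ S₁ → b ∈ S₁ → a = b := fun j hj => by
    have : 0 < T₁.ncard := (Set.ncard_pos (Set.toFinite _)).2 ⟨j, hj⟩
    have hle : S₁.ncard ≤ 1 := by nlinarith
    exact fun a b => (Set.ncard_le_one_iff (Set.toFinite _)).1 hle
  refine triangleAttachment_isVertexSplit.bookFree le_rfl (fun p hp => ?_) (fun q hq => ?_)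
  · rw [degIn_eq_card, card_le_one]
    simp only [mem_insert, mem_image, Set.mem_toFinset, mem_filter] at hp ⊢
    rcases hp with rfl | ⟨i, hi, rfl⟩
    · rintro a ⟨rfl | ⟨j, hj, rfl⟩, ha⟩ b ⟨rfl | ⟨j', hj', rfl⟩, hb⟩ <;> simp_all
    · rintro a ⟨rfl | ⟨j, hj, rfl⟩, ha⟩ b ⟨rfl | ⟨j', hj', rfl⟩, hb⟩ <;> simp_all
      exact hS i hi _ _ hj hj'
  · rw [degIn_eq_card, card_le_one]
    simp only [mem_insert, mem_image, Set.mem_toFinset, mem_filter] at hq ⊢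
    rcases hq with rfl | ⟨i, hi, rfl⟩
    · rintro a ⟨rfl | ⟨j, hj, rfl⟩, ha⟩ b ⟨rfl | ⟨j', hj', rfl⟩, hb⟩ <;> simp_all
    · rintro a ⟨rfl | ⟨j, hj, rfl⟩, ha⟩ b ⟨rfl | ⟨j', hj', rfl⟩, hb⟩ <;> simp_all
      exact hT i hi _ _ hj hj'

/-- Every vertex of `S` and `T` sends exactly one edge to the triangle, so the count does not depend
on `S₁` and `T₁`. -/
theorem triangleAttachment_ncard_edgeSet :
    (triangleAttachment S₁ T₁).edgeSet.ncard =
      (Fintype.card S + 1) * (Fintype.card T + 1) + 2 := by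
  classical
  have h := two_mul_ncard_edgeSet (triangleAttachment S₁ T₁)
  rw [pairCount_eq_sum] at h
  simp only [Fintype.sum_sum_type, Fin.sum_univ_three] at h
  have h1 : (∑ i : S, if i ∈ S₁ then 1 else 0) + (∑ i : S, if i ∉ S₁ then 1 else 0)
      = Fintype.card S := by
    rw [← card_filter, ← card_filter, card_filter_add_card_filter_not, card_univ]
  have h2 : (∑ i : T, if i ∈ T₁ then 1 else 0) + (∑ i : T, if i ∉ T₁ then 1 else 0)
      = Fintype.card T := by
    rw [← card_filter, ← card_filter, card_filter_add_card_filter_not, card_univ]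
  simp [sum_add_distrib] at h h1 h2
  have h3 : Fintype.card T * Fintype.card S = Fintype.card S * Fintype.card T := mul_comm _ _
  have h4 : (Fintype.card S + 1) * (Fintype.card T + 1) + 2 =
    Fintype.card S * Fintype.card T + Fintype.card S + Fintype.card T + 3 := by ring
  omega

end triangleAttachment

end SimpleGraph

end

/-! ### Recognising the extremal graphs -/

section

open Finset

namespace SimpleGraph

variable {V : Type*} {G : SimpleGraph V} {r : ℕ}

theorem ncard_setOf_mem_add_one [DecidableEq V] {X P : Finset V} {p : V} {s : ℕ} (hP : P ⊆ X)
    (hp : p ∈ P) (e : Fin s ≃ X.erase p) : {i | (e i : V) ∈ P}.ncard + 1 = #P := by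
  have hi : Function.Injective fun i => (e i : V) := Subtype.val_injective.comp e.injective
  rw [← card_erase_add_one hp, ← Set.ncard_image_of_injective _ hi, ← Set.ncard_coe_finset]
  congr 2
  ext z
  simp only [Set.mem_image, Set.mem_ofPred_eq, coe_erase, Set.mem_sdiff, mem_coe,
    Set.mem_singleton_iff]
  constructor
  · rintro ⟨i, hi, rfl⟩
    exact ⟨hi, (mem_erase.1 (e i).2).1⟩
  · rintro ⟨hz, hzp⟩
    exact ⟨e.symm ⟨z, mem_erase.2 ⟨hzp, hP hz⟩⟩, by simpa using hz, by simp⟩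

/-- The edge `pq` completes the triangle with `w`: `q`, `p`, `w` play `w₁`, `w₂`, `w₃`, and `S₁`,
`T₁` are what remains of `P`, `Q`. -/
theorem IsVertexSplit.exists_iso_triangleAttachment {w p q : V} {X Y P Q : Finset V} {s t : ℕ}
    (h : G.IsVertexSplit w X Y P Q) (hX : #X = s + 1) (hY : #Y = t + 1) (hp : p ∈ P) (hq : q ∈ Q)
    (hpq : G.Adj p q) (hpQ : ∀ y ∈ Q, G.Adj p y → y = q) (hPq : ∀ x ∈ P, G.Adj x q → x = p)
    (hadj : ∀ x ∈ X, ∀ y ∈ Y, x ∉ P ∨ y ∉ Q → G.Adj x y)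
    (hadj' : ∀ x ∈ P, ∀ y ∈ Q, x ≠ p → y ≠ q → G.Adj x y) :
    ∃ (S₁ : Set (Fin s)) (T₁ : Set (Fin t)), S₁.ncard + 1 = #P ∧ T₁.ncard + 1 = #Q ∧
      Nonempty (G ≃g triangleAttachment S₁ T₁) := by
  classical
  have hpX := h.P_subset hp
  have hqY := h.Q_subset hq
  let e : Fin s ≃ X.erase p := ((X.erase p).equivFinOfCardEq (by
    rw [card_erase_of_mem hpX, hX, Nat.add_sub_cancel])).symm
  let e' : Fin t ≃ Y.erase q := ((Y.erase q).equivFinOfCardEq (by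
    rw [card_erase_of_mem hqY, hY, Nat.add_sub_cancel])).symm
  refine ⟨{i | (e i : V) ∈ P}, {j | (e' j : V) ∈ Q}, ncard_setOf_mem_add_one h.P_subset hp e,
    ncard_setOf_mem_add_one h.Q_subset hq e', ?_⟩
  have he : ∀ i, (e i : V) ∈ X ∧ (e i : V) ≠ p := fun i => (mem_erase.1 (e i).2).symm
  have he' : ∀ i, (e' i : V) ∈ Y ∧ (e' i : V) ≠ q := fun i => (mem_erase.1 (e' i).2).symm
  have hXY : ∀ x ∈ X, ∀ y ∈ Y, x ≠ y := fun x hx y hy hxy =>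
    Finset.disjoint_left.1 h.disjoint hx (hxy ▸ hy)
  have hXw : ∀ x ∈ X, x ≠ w := fun x hx hxw => h.notMem_left (hxw ▸ hx)
  have hYw : ∀ y ∈ Y, y ≠ w := fun y hy hyw => h.notMem_right (hyw ▸ hy)
  let f : (Fin s ⊕ Fin t) ⊕ Fin 3 → V := fun
    | .inl (.inl i) => e i
    | .inl (.inr j) => e' j
    | .inr a => ![q, p, w] a
  refine nonempty_iso_of_bijective (f := f) ?_ ?_ ?_
  · have h1 : ∀ i j, (e i : V) = e j → i = j := fun i j hij => e.injective (Subtype.ext hij)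
    have h2 : ∀ i j, (e' i : V) = e' j → i = j := fun i j hij => e'.injective (Subtype.ext hij)
    have h3 : ∀ i j, (e i : V) ≠ e' j := fun i j => hXY _ (he i).1 _ (he' j).1
    have h4 : ∀ i a, (e i : V) ≠ ![q, p, w] a := fun i a => by
      fin_cases a
      · exact hXY _ (he i).1 _ hqY
      · exact (he i).2
      · exact hXw _ (he i).1
    have h5 : ∀ i a, (e' i : V) ≠ ![q, p, w] a := fun i a => by
      fin_cases a
      · exact (he' i).2
      · exact (hXY _ hpX _ (he' i).1).symm
      · exact hYw _ (he' i).1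
    rintro ((i | i) | a) ((j | j) | b) hij
    · rw [h1 i j hij]
    · exact absurd hij (h3 i j)
    · exact absurd hij (h4 i b)
    · exact absurd hij (h3 j i).symm
    · rw [h2 i j hij]
    · exact absurd hij (h5 i b)
    · exact absurd hij (h4 j a).symm
    · exact absurd hij (h5 j a).symm
    · have n1 := hXY p hpX q hqY
      have n2 := hXw p hpX
      have n3 := hYw q hqY
      have h6 : ∀ a b, ![q, p, w] a = ![q, p, w] b → a = b := by
        simp [Fin.forall_fin_succ, n1, n2, n3, n1.symm, n2.symm, n3.symm]
      rw [h6 a b hij]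
  · intro z
    rcases h.cover z with rfl | hz | hz
    · exact ⟨.inr 2, rfl⟩
    · by_cases hzp : z = p
      · exact ⟨.inr 1, hzp.symm⟩
      · exact ⟨.inl (.inl (e.symm ⟨z, mem_erase.2 ⟨hzp, hz⟩⟩)), by simp [f]⟩
    · by_cases hzq : z = q
      · exact ⟨.inr 0, hzq.symm⟩
      · exact ⟨.inl (.inr (e'.symm ⟨z, mem_erase.2 ⟨hzq, hz⟩⟩)), by simp [f]⟩
  · have h1 : ∀ i j, G.Adj (e i) (e' j) := fun i j => by
      by_cases hiP : (e i : V) ∈ P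
      · by_cases hjQ : (e' j : V) ∈ Q
        · exact hadj' _ hiP _ hjQ (he i).2 (he' j).2
        · exact hadj _ (he i).1 _ (he' j).1 (.inr hjQ)
      · exact hadj _ (he i).1 _ (he' j).1 (.inl hiP)
    have h2 : ∀ i j, ¬ G.Adj (e i) (e j) := fun i j =>
      h.not_adj_left _ (he i).1 _ (he j).1
    have h3 : ∀ i j, ¬ G.Adj (e' i) (e' j) := fun i j =>
      h.not_adj_right _ (he' i).1 _ (he' j).1
    have h4 : ∀ i, G.Adj q (e i) ↔ (e i : V) ∉ P := fun i => by
      rw [G.adj_comm]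
      exact ⟨fun hi hiP => (he i).2 (hPq _ hiP hi), fun hi => hadj _ (he i).1 _ hqY (.inl hi)⟩
    have h5 : ∀ j, G.Adj p (e' j) ↔ (e' j : V) ∉ Q := fun j =>
      ⟨fun hj hjQ => (he' j).2 (hpQ _ hjQ hj), fun hj => hadj _ hpX _ (he' j).1 (.inr hj)⟩
    have h6 : ∀ i, ¬ G.Adj p (e i) := fun i => h.not_adj_left _ hpX _ (he i).1
    have h7 : ∀ j, ¬ G.Adj q (e' j) := fun j => h.not_adj_right _ hqY _ (he' j).1
    have h8 : ∀ i, G.Adj w (e i) ↔ (e i : V) ∈ P := fun i => by rw [h.mem_P]; simp [(he i).1]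
    have h9 : ∀ j, G.Adj w (e' j) ↔ (e' j : V) ∈ Q := fun j => by rw [h.mem_Q]; simp [(he' j).1]
    have n1 : G.Adj w p := ((h.mem_P p).1 hp).2
    have n2 : G.Adj w q := ((h.mem_Q q).1 hq).2
    have key1 : ∀ i a, G.Adj (e i) (![q, p, w] a) ↔
        (a = 0 ∧ (e i : V) ∉ P) ∨ (a = 2 ∧ (e i : V) ∈ P) := fun i a => by
      rw [G.adj_comm]
      fin_cases a
      · simpa using h4 i
      · simpa using h6 i
      · simpa using h8 i
    have key2 : ∀ j a, G.Adj (e' j) (![q, p, w] a) ↔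
        (a = 1 ∧ (e' j : V) ∉ Q) ∨ (a = 2 ∧ (e' j : V) ∈ Q) := fun j a => by
      rw [G.adj_comm]
      fin_cases a
      · simpa using h7 j
      · simpa using h5 j
      · simpa using h9 j
    rintro ((i | i) | a) ((j | j) | b)
    · simpa [f] using h2 i j
    · simpa [f] using h1 i j
    · simpa [f] using key1 i b
    · simpa [f] using (h1 j i).symm
    · simpa [f] using h3 i j
    · simpa [f] using key2 i b
    · rw [G.adj_comm]
      simpa [f] using key1 j a
    · rw [G.adj_comm]
      simpa [f] using key2 j a
    · fin_cases a <;> fin_cases b <;> simp [f, hpq, hpq.symm, n1, n2, n1.symm, n2.symm]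

/-- For `r = 1` the edges between `P` and `Q` form a matching, and any of them serves as `pq`. -/
theorem IsVertexSplit.exists_matching_edge [Finite V] {w : V} {X Y P Q : Finset V}
    (h : G.IsVertexSplit w X Y P Q) (hB : G.BookFree 1)
    (hc : (#P = 1 ∨ #Q = 1) ∧ G.pairCount P Q = 1 ∨ #P = 2 ∧ #Q = 2 ∧ G.pairCount P Q = 2) :
    ∃ p ∈ P, ∃ q ∈ Q, G.Adj p q ∧ (∀ y ∈ Q, G.Adj p y → y = q) ∧ (∀ x ∈ P, G.Adj x q → x = p) ∧
      (∀ x ∈ P, ∀ y ∈ Q, x ≠ p → y ≠ q → G.Adj x y) := by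
  classical
  have hP1 : ∀ p ∈ P, ∀ y ∈ Q, ∀ z ∈ Q, G.Adj p y → G.Adj p z → y = z := by
    intro p hp y hy z hz hpy hpz
    have := hB.degIn_le ((h.mem_P p).1 hp).2 (fun z hz => ((h.mem_Q z).1 hz).2)
    rw [degIn_eq_card, card_le_one] at this
    exact this y (mem_filter.2 ⟨hy, hpy⟩) z (mem_filter.2 ⟨hz, hpz⟩)
  have hQ1 : ∀ q ∈ Q, ∀ y ∈ P, ∀ z ∈ P, G.Adj q y → G.Adj q z → y = z := by
    intro q hq y hy z hz hqy hqz
    have := hB.degIn_le ((h.mem_Q q).1 hq).2 (fun z hz => ((h.mem_P z).1 hz).2)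
    rw [degIn_eq_card, card_le_one] at this
    exact this y (mem_filter.2 ⟨hy, hqy⟩) z (mem_filter.2 ⟨hz, hqz⟩)
  have hpos : ∃ p ∈ P, 0 < G.degIn Q p := by
    by_contra! hcon
    have : G.pairCount P Q = 0 := sum_eq_zero fun x hx => Nat.le_zero.1 (hcon x hx)
    omega
  obtain ⟨p, hp, hdp⟩ := hpos
  rw [degIn_eq_card, card_pos] at hdp
  obtain ⟨q, hq⟩ := hdp
  obtain ⟨hq, hpq⟩ := mem_filter.1 hq
  refine ⟨p, hp, q, hq, hpq, fun y hy hpy => hP1 p hp y hy q hq hpy hpq,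
    fun x hx hxq => hQ1 q hq x hx p hp hxq.symm hpq.symm, fun x hx y hy hxp hyq => ?_⟩
  rcases hc with ⟨h1 | h1, -⟩ | ⟨h1, h2, h3⟩
  · exact absurd (card_le_one.1 h1.le x hx p hp) hxp
  · exact absurd (card_le_one.1 h1.le y hy q hq) hyq
  · have hP : {p, x} = P := eq_of_subset_of_card_le (by simp [insert_subset_iff, hp, hx])
      (by rw [card_pair hxp.symm, h1])
    have hQ : {q, y} = Q := eq_of_subset_of_card_le (by simp [insert_subset_iff, hq, hy])
      (by rw [card_pair hyq.symm, h2])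
    -- At most one of the two edges is at `p`, so `x` has one too. It cannot end at `q`, which is
    -- already matched to `p`.
    have hs : G.degIn Q p + G.degIn Q x = 2 := by
      rw [← h3, pairCount, ← hP, sum_pair hxp.symm]
    have hd := hB.degIn_le ((h.mem_P p).1 hp).2 (fun z hz => ((h.mem_Q z).1 hz).2)
    have hdx : 0 < G.degIn Q x := by omega
    rw [degIn_eq_card, card_pos] at hdx
    obtain ⟨z, hz⟩ := hdx
    obtain ⟨hz, hxz⟩ := mem_filter.1 hz
    rw [← hQ, mem_insert, mem_singleton] at hz
    rcases hz with rfl | rfl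
    · exact absurd (hQ1 z hq x hx p hp hxz.symm hpq.symm) hxp
    · exact hxz

theorem isNonBipartiteFree_iff [Finite V] :
    IsNonBipartiteFree (bookGraph (r + 1)) G ↔ ¬ G.IsBipartite ∧ G.BookFree r := by
  rw [IsNonBipartiteFree, free_bookGraph_iff]

theorem div_two_mul_div_two (n : ℕ) : (n - 1) / 2 * (n / 2) = (n - 1) ^ 2 / 4 := by
  rw [mul_eq_sq_div_four (by omega) (by omega)]
  congr 2
  omega

/-- A square is `0` or `1` modulo `4`, so the floor loses at most the `1` of `(n - 1)² = n² - 2n +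
1`. -/
theorem sq_add_eight_mul_le {n e r : ℕ} (hn : 1 ≤ n) (h : (n - 1) ^ 2 / 4 + 2 * r ≤ e) :
    n ^ 2 + 8 * r ≤ 4 * e + 2 * n := by
  obtain ⟨k, rfl⟩ : ∃ k, n = k + 1 := ⟨n - 1, by omega⟩
  rw [Nat.add_sub_cancel] at h
  have h1 : (k + 1) ^ 2 = k ^ 2 + 2 * k + 1 := by ring
  have h2 : k ^ 2 % 4 ≤ 1 := by
    rcases Nat.even_or_odd' k with ⟨c, rfl | rfl⟩
    · have : (2 * c) ^ 2 = 4 * c ^ 2 := by ring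
      omega
    · have : (2 * c + 1) ^ 2 = 4 * (c ^ 2 + c) + 1 := by ring
      omega
  omega

theorem ncard_edgeSet_le_and_eq {n r : ℕ} (hr : 1 ≤ r) (hn : 25760 * (r + 1) ^ 3 ≤ n)
    {G : SimpleGraph (Fin n)} (hG : IsNonBipartiteFree (bookGraph (r + 1)) G) :
    G.edgeSet.ncard ≤ (n - 1) ^ 2 / 4 + 2 * r ∧
    (G.edgeSet.ncard = (n - 1) ^ 2 / 4 + 2 * r →
      (r = 1 → G ∈ familyG1 n) ∧
      (2 ≤ r → Nonempty (G ≃g bipartitePlusVertex r ((n - 1) / 2) (n / 2)))) := by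
  rw [isNonBipartiteFree_iff] at hG
  obtain ⟨hbip, hB⟩ := hG
  rcases lt_or_ge G.edgeSet.ncard ((n - 1) ^ 2 / 4 + 2 * r) with hlt | hge
  · exact ⟨hlt.le, fun h => absurd h hlt.ne⟩
  have hs3 : r + 1 ≤ (r + 1) ^ 3 := Nat.le_self_pow (by norm_num) _
  obtain ⟨w, A, hA⟩ := hB.exists_bipartite_delete (Fintype.card_fin n) hn
    (sq_add_eight_mul_le (by omega) hge)
  obtain ⟨X, Y, P, Q, hs⟩ := exists_isVertexSplit G hA
  have hmain := hs.ncard_edgeSet_le hbip hr hB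
  rw [Fintype.card_fin] at hmain
  refine ⟨hmain.1, fun he => ?_⟩
  obtain ⟨hXY, hadj, hc⟩ := hmain.2 he
  have hcard := hs.card_add_card
  rw [Fintype.card_fin] at hcard
  have hn1 : n - 1 = #X + #Y := by omega
  rw [hn1] at hXY
  have hle := le_add_one_of_mul_eq hXY
  have hle' := le_add_one_of_mul_eq (s := #Y) (t := #X) (by rw [mul_comm, add_comm, hXY])
  constructor
  · rintro rfl
    have hc' : (#P = 1 ∨ #Q = 1) ∧ G.pairCount P Q = 1 ∨
        #P = 2 ∧ #Q = 2 ∧ G.pairCount P Q = 2 := by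
      rcases hc with ⟨h1, h2, h3⟩ | ⟨-, h⟩
      · exact .inl ⟨.inl h1, by rw [h3, h1, h2]⟩
      · exact h
    obtain ⟨p, hp, q, hq, hpq, h1, h2, h3⟩ := hs.exists_matching_edge hB hc'
    obtain ⟨S₁, T₁, hS, hT, hiso⟩ := hs.exists_iso_triangleAttachment (s := #X - 1) (t := #Y - 1)
      (by omega) (by omega) hp hq hpq h1 h2 hadj h3
    refine ⟨#X - 1, #Y - 1, by omega, by omega, by omega, S₁, T₁, ?_, hiso⟩
    rcases hc' with ⟨h | h, -⟩ | ⟨h, h', -⟩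
    · have : S₁.ncard = 0 := by omega
      simp [this]
    · have : T₁.ncard = 0 := by omega
      simp [this]
    · have e1 : S₁.ncard = 1 := by omega
      have e2 : T₁.ncard = 1 := by omega
      simp [e1, e2]
  · intro hr2
    obtain ⟨hP, hQ, hPQ⟩ : #P = r ∧ #Q = r ∧ G.pairCount P Q = #P * #Q := by
      rcases hc with h | ⟨h, -⟩
      · exact h
      · omega
    classical
    have h5 := G.pairCount_add_pairCount_compl (hs.disjoint.mono hs.P_subset hs.Q_subset)
    have hfull : ∀ x ∈ X, ∀ y ∈ Y, G.Adj x y := by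
      intro x hx y hy
      by_cases hxy : x ∉ P ∨ y ∉ Q
      · exact hadj x hx y hy hxy
      · rw [not_or, not_not, not_not] at hxy
        by_contra hnot
        have h0 : Gᶜ.pairCount P Q = 0 := by omega
        have hd : Gᶜ.degIn Q x = 0 := sum_eq_zero_iff.1 h0 x hxy.1
        rw [degIn_eq_card, card_eq_zero, filter_eq_empty_iff] at hd
        refine hd hxy.2 ?_
        rw [compl_adj]
        exact ⟨fun e => Finset.disjoint_left.1 hs.disjoint hx (e ▸ hy), hnot⟩
    -- The model has its smaller part first, and `n / 2` is the ceiling of `(n - 1) / 2`.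
    rcases le_total #X #Y with hXle | hYle
    · exact hs.nonempty_iso_bipartitePlusVertex (by omega) (by omega) hP hQ hfull
    · exact hs.swap.nonempty_iso_bipartitePlusVertex (by omega) (by omega) hQ hP
        fun y hy x hx => (hfull x hx y hy).symm

theorem isNonBipartiteFree_of_iso_bipartitePlusVertex {n r : ℕ} (hr : 1 ≤ r)
    (hn : 2 * r + 1 ≤ n) {G : SimpleGraph (Fin n)}
    (e : G ≃g bipartitePlusVertex r ((n - 1) / 2) (n / 2)) :
    IsNonBipartiteFree (bookGraph (r + 1)) G ∧
      G.edgeSet.ncard = (n - 1) ^ 2 / 4 + 2 * r := by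
  have h1 : r ≤ (n - 1) / 2 := by omega
  have h2 : r ≤ n / 2 := by omega
  rw [isNonBipartiteFree_iff, e.ncard_edgeSet, bipartitePlusVertex_ncard_edgeSet h1 h2,
    div_two_mul_div_two]
  exact ⟨⟨e.not_isBipartite (bipartitePlusVertex_not_isBipartite hr h1 h2),
    (bipartitePlusVertex_bookFree hr h1 h2).map_iso e.symm⟩, rfl⟩

theorem isNonBipartiteFree_of_mem_familyG1 {n : ℕ} {G : SimpleGraph (Fin n)}
    (hG : G ∈ familyG1 n) :
    IsNonBipartiteFree (bookGraph (1 + 1)) G ∧ G.edgeSet.ncard = (n - 1) ^ 2 / 4 + 2 := by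
  obtain ⟨s, t, hst, h1, h2, S₁, T₁, h, ⟨e⟩⟩ := hG
  have hn : n - 1 = (s + 1) + (t + 1) := by omega
  rw [isNonBipartiteFree_iff, e.ncard_edgeSet, triangleAttachment_ncard_edgeSet,
    Fintype.card_fin, Fintype.card_fin, hn, ← mul_eq_sq_div_four (by omega) (by omega)]
  exact ⟨⟨e.not_isBipartite triangleAttachment_not_isBipartite,
    (triangleAttachment_bookFree h).map_iso e.symm⟩, rfl⟩

theorem exists_iso_bipartitePlusVertex {n : ℕ} (hn : 1 ≤ n) (r : ℕ) :
    ∃ G : SimpleGraph (Fin n),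
      Nonempty (G ≃g bipartitePlusVertex r ((n - 1) / 2) (n / 2)) := by
  have hc : Fintype.card (Fin n) = Fintype.card (Option (Fin ((n - 1) / 2) ⊕ Fin (n / 2))) := by
    simp
    omega
  exact ⟨(bipartitePlusVertex r ((n - 1) / 2) (n / 2)).comap (Fintype.equivOfCardEq hc),
    ⟨Iso.comap _ _⟩⟩

end SimpleGraph

end

/-! ### The theorem -/

theorem nonBipartiteExtremalGraphs_eq {W : Type*} {H : SimpleGraph W} {n m : ℕ}
    (h : IsGreatest (nonBipartiteEdgeNumbers n H) m) :
    nonBipartiteExtremalGraphs n H = {G | IsNonBipartiteFree H G ∧ G.edgeSet.ncard = m} := by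
  obtain ⟨⟨G₀, hG₀, hm⟩, hub⟩ := h
  ext G
  constructor
  · rintro ⟨hG, hmax⟩
    exact ⟨hG, le_antisymm (hub ⟨G, hG, rfl⟩) (hm ▸ hmax G₀ hG₀)⟩
  · rintro ⟨hG, rfl⟩
    exact ⟨hG, fun G' hG' => hub ⟨G', hG', rfl⟩⟩

theorem theorem1p10 (r : ℕ) (hr : 1 ≤ r) :
    ∃ n₀ : ℕ, ∀ n : ℕ, n₀ ≤ n →
      IsGreatest (nonBipartiteEdgeNumbers n (bookGraph (r + 1))) ((n - 1) ^ 2 / 4 + 2 * r) ∧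
      (r = 1 → nonBipartiteExtremalGraphs n (bookGraph (r + 1)) = familyG1 n) ∧
      (2 ≤ r → nonBipartiteExtremalGraphs n (bookGraph (r + 1)) =
        {G : SimpleGraph (Fin n) |
          Nonempty (G ≃g bipartitePlusVertex r ((n - 1) / 2) (n / 2))}) := by
  refine ⟨25760 * (r + 1) ^ 3, fun n hn => ?_⟩
  have hs3 : r + 1 ≤ (r + 1) ^ 3 := Nat.le_self_pow (by norm_num) _
  have hgreatest : IsGreatest (nonBipartiteEdgeNumbers n (bookGraph (r + 1)))
      ((n - 1) ^ 2 / 4 + 2 * r) := by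
    constructor
    · obtain ⟨G, ⟨e⟩⟩ := SimpleGraph.exists_iso_bipartitePlusVertex (n := n) (by omega) r
      exact ⟨G, SimpleGraph.isNonBipartiteFree_of_iso_bipartitePlusVertex hr (by omega) e⟩
    · rintro _ ⟨G, hG, rfl⟩
      exact (SimpleGraph.ncard_edgeSet_le_and_eq hr hn hG).1
  refine ⟨hgreatest, ?_, fun hr2 => ?_⟩
  · rintro rfl
    rw [nonBipartiteExtremalGraphs_eq hgreatest]
    ext G
    exact ⟨fun h => ((SimpleGraph.ncard_edgeSet_le_and_eq hr hn h.1).2 h.2).1 rfl,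
      fun h => SimpleGraph.isNonBipartiteFree_of_mem_familyG1 h⟩
  · rw [nonBipartiteExtremalGraphs_eq hgreatest]
    ext G
    exact ⟨fun h => ((SimpleGraph.ncard_edgeSet_le_and_eq hr hn h.1).2 h.2).2 hr2,
      fun ⟨e⟩ => SimpleGraph.isNonBipartiteFree_of_iso_bipartitePlusVertex hr (by omega) e⟩
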